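/- Let $E$ be a finite set of items, $O$ a set of states, and $p$ a (discrete) probability distribution on realizations $\phi:E\to O$; let $\Phi\sim p$. Let $f:2^E\times O^E\to\mathbb{R}_{\ge 0}$ be a utility function with $\mathbb{E}[f(S,\Phi)]<\infty$ for every $S\subseteq E$. A partial realization is a map $\psi:\mathrm{dom}(\psi)\to O$ with $\mathrm{dom}(\psi)\subseteq E$; write $\psi\prec\phi$ if $\phi$ extends $\psi$, and $\psi\subseteq\psi'$ if $\psi'$ extends $\psi$. For $e\in E$ and $\psi$ with $\Pr[\psi\prec\Phi]>0$ let $$\Delta(e\mid\psi)=\mathbb{E}\big[f(\mathrm{dom}(\psi)\cup\{e\},\Phi)-f(\mathrm{dom}(\psi),\Phi)\,\big|\,\psi\prec\Phi\big].$$ Assume that $f$ is adaptive submodular with respect to $p$: $\Delta(e\mid\psi)\ge\Delta(e\mid\psi')$ whenever $\psi\subseteq\psi'$, $\Pr[\psi'\prec\Phi]>0$ and $e\notin\mathrm{dom}(\psi')$. (Pointwise submodularity and monotonicity are not assumed.) Let $k\ge 1$ be an integer and let $(E,\mathcal{I})$ be a $k$-system: $\emptyset\in\mathcal{I}$, $\mathcal{I}$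 is closed under taking subsets, and for every $R\subseteq E$ any two inclusion-maximal independent subsets $B,B'$ of $R$ satisfy $|B|\le k|B'|$. An adaptive (possibly randomized) policy $\pi$ repeatedly either stops or selects an item not selected before, depending only on the states of the items selected so far and on its own randomness, which is independent of $\Phi$; selecting $e$ reveals $\Phi(e)$. Let $E(\pi,\phi)$ be the random set of items that $\pi$ selects under the realization $\phi$, and let $f_{avg}(\pi)=\mathbb{E}[f(E(\pi,\Phi),\Phi)]$. The policy $\pi$ is feasible if $E(\pi,\phi)\in\mathcal{I}$ (surely) for every $\phi$ with $p(\phi)>0$. For $\delta_0,\delta_1\in[0,1]$, the sampling-based adaptive greedy policy $\pi^{sag}$ is the following. Draw a random set $S_1\subseteq E$ containing each item independently with probability $\delta_0$ and put $S_2=E\setminus S_1$. Independently, let $S=S_1$ with probability $\delta_1$ and $S=S_2$ with probability $1-\delta_1$. Starting from $\psi=\emptyset$, as long as the set $$F=\{e\in S\setminus\mathrm{dom}(\psi)\;:\;\mathrm{dom}(\psi)\cup\{e\}\in\mathcal{I},\ \Delta(e\mid\psi)>0\}$$ is non-empty, select an item $e\in\arg\max_{e\in F}\Delta(e\mid\psi)$,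 observe $\Phi(e)$ and add $(e,\Phi(e))$ to $\psi$; stop when $F$ is empty. Ties in the $\arg\max$ are broken by an arbitrary fixed priority order on $E$, which may depend on $\psi$. Then, for $\delta_1=\delta_0=\frac12$, the policy $\pi^{sag}$ is feasible, and for every feasible policy $\pi$ (in particular for an optimal feasible policy $\pi^{opt}$) $$f_{avg}(\pi^{sag})\ \ge\ \frac{1}{2k+4}\,f_{avg}(\pi).$$ -/

import Mathlib

open scoped NNReal ENNReal

noncomputable section

namespace AdaptiveSubmodular

universe u v

variable {E : Type u} {O : Type v}

/-- A partial realization: `ψ e = some o` if the state `o` of item `e` has been observed, and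
`ψ e = none` if `e` is outside the domain. -/
abbrev PartialRealization (E : Type u) (O : Type v) := E → Option O

/-- The domain of a partial realization. -/
def dom [Fintype E] (ψ : PartialRealization E O) : Finset E :=
  Finset.univ.filter fun e => (ψ e).isSome

/-- `ψ ≺ φ`: the partial realization `ψ` agrees with `φ` on the domain of `ψ`. -/
def Consistent (ψ : PartialRealization E O) (φ : E → O) : Prop :=
  ∀ e o, ψ e = some o → φ e = o

/-- `ψ ⊆ ψ'`: `ψ` is a subrealization of `ψ'`. -/
def Subrealization (ψ ψ' : PartialRealization E O) : Prop :=
  ∀ e o, ψ e = some o → ψ' e = some o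

/-- `Pr[ψ ≺ Φ]` for `Φ ∼ p`. -/
def probConsistent (p : PMF (E → O)) (ψ : PartialRealization E O) : ℝ :=
  ∑' φ, {φ | Consistent ψ φ}.indicator (fun φ => (p φ).toReal) φ

/-- The conditional expected marginal utility `Δ(e ∣ ψ)`, meaningful if `Pr[ψ ≺ Φ] > 0`. -/
def marginal [Fintype E] [DecidableEq E] (p : PMF (E → O)) (f : Finset E → (E → O) → ℝ)
    (e : E) (ψ : PartialRealization E O) : ℝ :=
  (∑' φ, {φ | Consistent ψ φ}.indicator
    (fun φ => (p φ).toReal * (f (insert e (dom ψ)) φ - f (dom ψ) φ)) φ) / probConsistent p ψ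

/-- Adaptive submodularity of `f` with respect to the prior `p`. The conditional expectations
exist exactly for partial realizations of positive probability. -/
def IsAdaptiveSubmodular [Fintype E] [DecidableEq E] (p : PMF (E → O))
    (f : Finset E → (E → O) → ℝ) : Prop :=
  ∀ ψ ψ' : PartialRealization E O, Subrealization ψ ψ' → 0 < probConsistent p ψ' →
    ∀ e, e ∉ dom ψ' → marginal p f e ψ' ≤ marginal p f e ψ

/-- `(E, I)` is an independence system. -/
def IsIndependenceSystem (I : Set (Finset E)) : Prop :=
  ∅ ∈ I ∧ ∀ A ∈ I, ∀ B, B ⊆ A → B ∈ I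

/-- `B` is a base of `R`: an inclusion-maximal independent subset of `R`. -/
def IsBaseOf (I : Set (Finset E)) (R B : Finset E) : Prop :=
  (B ∈ I ∧ B ⊆ R) ∧ ∀ A ∈ I, A ⊆ R → B ⊆ A → B = A

/-- `(E, I)` is a `k`-system: any two bases of the same set have sizes within a factor `k`. -/
def IsKSystem (I : Set (Finset E)) (k : ℕ) : Prop :=
  IsIndependenceSystem I ∧ 1 ≤ k ∧
    ∀ R B B' : Finset E, IsBaseOf I R B → IsBaseOf I R B' → B.card ≤ k * B'.card

/-- An adaptive policy: a map from observations to distributions of the next action, which is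
either `some e` (select the new item `e`) or `none` (stop). -/
structure Policy (E : Type u) (O : Type v) where
  next : PartialRealization E O → PMF (Option E)
  fresh : ∀ ψ e, some e ∈ (next ψ).support → ψ e = none

/-- The observation after `n` further steps of `π` from the observation `ψ`, under the
realization `φ`. -/
def Policy.run [DecidableEq E] (π : Policy E O) (φ : E → O) :
    ℕ → PartialRealization E O → PMF (PartialRealization E O)
  | 0, ψ => PMF.pure ψ
  | n + 1, ψ => (π.next ψ).bind fun a =>
      match a with
      | none => PMF.pure ψ
      | some e => π.run φ n (Function.update ψ e (some (φ e)))

/-- The law of the set `E(π, φ)` of items selected by `π` under `φ`. Since a policy selects new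
items only, it has stopped after at most `|E|` steps. -/
def Policy.selected [Fintype E] [DecidableEq E] (π : Policy E O) (φ : E → O) :
    PMF (Finset E) :=
  (π.run φ (Fintype.card E) fun _ => none).map dom

/-- A randomized policy: a policy drawn at random before the first selection (the policy drawn
may randomize further along its run). -/
abbrev RandomizedPolicy (E : Type u) (O : Type v) := PMF (Policy E O)

/-- The law of the set `E(π, φ)` for a randomized policy. -/
def selected [Fintype E] [DecidableEq E] (π : RandomizedPolicy E O) (φ : E → O) :
    PMF (Finset E) :=
  π.bind fun π' => π'.selected φ

/-- The expected utility `f_avg(π)`, over `Φ ∼ p` and the internal randomness of `π`. -/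
def favg [Fintype E] [DecidableEq E] (p : PMF (E → O)) (f : Finset E → (E → O) → ℝ)
    (π : RandomizedPolicy E O) : ℝ :=
  ∑' φ, (p φ).toReal * ∑ S : Finset E, (selected π φ S).toReal * f S φ

/-- `π ∈ Ω`: under every realization of positive probability, the set selected by `π` is
(surely) independent. -/
def Feasible [Fintype E] [DecidableEq E] (p : PMF (E → O)) (I : Set (Finset E))
    (π : RandomizedPolicy E O) : Prop :=
  ∀ φ ∈ p.support, ∀ S ∈ (selected π φ).support, S ∈ I

open scoped Classical in
/-- The candidates of the greedy rule at the observation `ψ`: the items of `S` not yet selected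
that keep the selection independent and have positive conditional expected marginal utility. -/
def candidates [Fintype E] [DecidableEq E] (p : PMF (E → O)) (f : Finset E → (E → O) → ℝ)
    (I : Set (Finset E)) (S : Finset E) (ψ : PartialRealization E O) : Finset E :=
  S.filter fun e => ψ e = none ∧ insert e (dom ψ) ∈ I ∧ 0 < marginal p f e ψ

/-- `e` is the element of `F` of largest marginal utility at `ψ`, ties being resolved in favour
of the smallest label. -/
def IsGreedyChoice [Fintype E] [DecidableEq E] (p : PMF (E → O)) (f : Finset E → (E → O) → ℝ)
    (label : E ↪ ℕ) (F : Finset E) (ψ : PartialRealization E O) (e : E) : Prop :=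
  e ∈ F ∧ (∀ e' ∈ F, marginal p f e' ψ ≤ marginal p f e ψ) ∧
    ∀ e' ∈ F, marginal p f e' ψ = marginal p f e ψ → label e ≤ label e'

theorem exists_isGreedyChoice [Fintype E] [DecidableEq E] (p : PMF (E → O))
    (f : Finset E → (E → O) → ℝ) (label : E ↪ ℕ) (F : Finset E)
    (ψ : PartialRealization E O) (hF : F.Nonempty) :
    ∃ e, IsGreedyChoice p f label F ψ e := by
  classical
  obtain ⟨m, hm, hmax⟩ := F.exists_max_image (fun e => marginal p f e ψ) hF
  obtain ⟨e, he, hmin⟩ :=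
    (F.filter fun e => marginal p f e ψ = marginal p f m ψ).exists_min_image label
      ⟨m, by simp [hm]⟩
  rw [Finset.mem_filter] at he
  refine ⟨e, he.1, fun e' h' => (hmax e' h').trans he.2.ge, fun e' h' heq => hmin e' ?_⟩
  rw [Finset.mem_filter]
  exact ⟨h', heq.trans he.2⟩

open scoped Classical in
/-- The next action of the greedy rule restricted to `S`. -/
def greedyStep [Fintype E] [DecidableEq E] (p : PMF (E → O)) (f : Finset E → (E → O) → ℝ)
    (I : Set (Finset E)) (tie : PartialRealization E O → (E ↪ ℕ)) (S : Finset E)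
    (ψ : PartialRealization E O) : Option E :=
  if h : (candidates p f I S ψ).Nonempty then
    some (exists_isGreedyChoice p f (tie ψ) _ ψ h).choose
  else none

theorem greedyStep_fresh [Fintype E] [DecidableEq E] (p : PMF (E → O))
    (f : Finset E → (E → O) → ℝ) (I : Set (Finset E))
    (tie : PartialRealization E O → (E ↪ ℕ)) (S : Finset E) (ψ : PartialRealization E O) (e : E)
    (h : greedyStep p f I tie S ψ = some e) : ψ e = none := by
  unfold greedyStep at h
  split_ifs at h with hne
  have hc := (exists_isGreedyChoice p f (tie ψ) _ ψ hne).choose_spec.1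
  rw [Option.some.inj h] at hc
  simp only [candidates, Finset.mem_filter] at hc
  exact hc.2.1

/-- The adaptive greedy policy that selects items from `S` only. -/
def greedyPolicy [Fintype E] [DecidableEq E] (p : PMF (E → O)) (f : Finset E → (E → O) → ℝ)
    (I : Set (Finset E)) (tie : PartialRealization E O → (E ↪ ℕ)) (S : Finset E) :
    Policy E O where
  next ψ := PMF.pure (greedyStep p f I tie S ψ)
  fresh ψ e h := greedyStep_fresh p f I tie S ψ e (by simpa using Eq.symm (by simpa using h))

/-- A coin showing `true` with probability `δ`. -/
def coin (δ : ℝ≥0) (hδ : δ ≤ 1) : PMF Bool :=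
  PMF.ofFintype (fun b => ((if b then δ else 1 - δ : ℝ≥0) : ℝ≥0∞)) (by
    rw [Fintype.sum_bool, ← ENNReal.coe_add]
    simp [add_tsub_cancel_of_le hδ])

/-- The random subset of `E` containing each item independently with probability `δ`. -/
def randomSubset (E : Type u) [Fintype E] (δ : ℝ≥0) (hδ : δ ≤ 1) : PMF (Finset E) :=
  PMF.ofFintype
    (fun S => ((δ ^ S.card * (1 - δ) ^ (Fintype.card E - S.card) : ℝ≥0) : ℝ≥0∞)) (by
    rw [← ENNReal.ofNNReal_finsetSum, Fintype.sum_pow_mul_eq_add_pow, add_tsub_cancel_of_le hδ]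
    simp)

/-- The sampling-based adaptive greedy policy `π^sag`: with probability `δ₁` run the greedy policy
on the random set `S₁`, and otherwise on its complement `S₂ = E \ S₁`, where `S₁` contains each
item independently with probability `δ₀`. -/
def sag [Fintype E] [DecidableEq E] (p : PMF (E → O)) (f : Finset E → (E → O) → ℝ)
    (I : Set (Finset E)) (tie : PartialRealization E O → (E ↪ ℕ))
    (δ₀ δ₁ : ℝ≥0) (h₀ : δ₀ ≤ 1) (h₁ : δ₁ ≤ 1) : RandomizedPolicy E O :=
  (coin δ₁ h₁).bind fun b => (randomSubset E δ₀ h₀).bind fun S₁ =>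
    PMF.pure (greedyPolicy p f I tie (if b then S₁ else S₁ᶜ))

end AdaptiveSubmodular

end

/-!
Write `A_S` for the set selected by the greedy rule on `S`. Adaptive submodularity says that, once
the states of the items selected so far are known, the conditional expected gain of a new item can
only decrease as the selection grows; summed along the run of a policy, this compares expected
utilities of unions of adaptively selected sets.

Let `T` be the set selected by a feasible policy. As `A_S` and `A_{Sᶜ}` are disjoint and `f ≥ 0`,
`E f(T) ≤ E f(T ∪ A_S) + E f(T ∪ A_{Sᶜ})`. Moreover `E f(T ∪ A_S)` is at most `E f(A_S)` plus the
expected marginal utilities, on top of `A_S`, of the items of `T` missed by `A_S`. A missed item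
`t` that stays unselected when `t` is added to `S` is blocked by the independence constraint, and
the `k`-system property bounds these items together by `k` times the total greedy gain on `S`. Any
other missed item is worth at most its own gain in the run on `insert t S`, and summing over all
`S` turns these gains into one further copy of the total greedy gain. Hence
`∑ S, E f(T ∪ A_S) ≤ (k + 2) ∑ S, E f(A_S)`, and `S` and `Sᶜ` together give `2 (k + 2)`.
-/

noncomputable section

namespace AdaptiveSubmodular

open MeasureTheory

universe u v

variable {E : Type u} {O : Type v}

section DiscreteLaw

variable {α : Type*} [MeasurableSpace α] [DiscreteMeasurableSpace α]

theorem integrable_toMeasure_of_summable {p : PMF α} {X : α → ℝ}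
    (hX : Summable fun a => (p a).toReal * X a) : Integrable X p.toMeasure := by
  refine ⟨Measurable.of_discrete.aestronglyMeasurable, ?_⟩
  rw [HasFiniteIntegral, ← p.restrict_toMeasure_support,
    lintegral_countable _ p.support_countable]
  have hterm (a : α) : ‖X a‖ₑ * p.toMeasure {a} = ‖(p a).toReal * X a‖ₑ := by
    rw [p.toMeasure_apply_singleton _ .of_discrete, enorm_mul, mul_comm,
      Real.enorm_of_nonneg ENNReal.toReal_nonneg, ENNReal.ofReal_toReal (p.apply_ne_top a)]
  simp only [hterm]
  have hnorm : Summable fun a => ‖(p a).toReal * X a‖₊ := by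
    simpa only [← NNReal.summable_coe, coe_nnnorm] using hX.norm
  exact (ENNReal.tsum_comp_le_tsum_of_injective Subtype.val_injective _).trans_lt
    (ENNReal.tsum_coe_ne_top_iff_summable.2 hnorm).lt_top

theorem ae_toMeasure_iff {p : PMF α} {P : α → Prop} :
    (∀ᵐ a ∂p.toMeasure, P a) ↔ ∀ a ∈ p.support, P a := by
  rw [ae_iff, p.toMeasure_apply_eq_zero_iff .of_discrete, Set.disjoint_left]
  simp

theorem toMeasure_ne_zero_of_mem {p : PMF α} {a : α} {s : Set α} (ha : a ∈ p.support)
    (has : a ∈ s) : p.toMeasure s ≠ 0 := by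
  rw [Ne, p.toMeasure_apply_eq_zero_iff .of_discrete, Set.not_disjoint_iff]
  exact ⟨a, ha, has⟩

end DiscreteLaw

section Mean

variable {α β : Type*} [Fintype α]

/-- The expectation of `g` under a law on a finite type. It is a finite sum, which avoids both a
measurable structure on `α` and integrability side conditions. -/
def mean (q : PMF α) (g : α → ℝ) : ℝ := ∑ a, (q a).toReal * g a

theorem mean_pure (a : α) (g : α → ℝ) : mean (PMF.pure a) g = g a := by
  classical
  simp [mean, PMF.pure_apply, apply_ite ENNReal.toReal]

theorem mean_const (q : PMF α) (c : ℝ) : mean q (fun _ => c) = c := by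
  have hq : ∑ a, (q a).toReal = 1 := by
    rw [← ENNReal.toReal_sum fun a _ => q.apply_ne_top a, ← tsum_fintype (L := .unconditional α),
      q.tsum_coe, ENNReal.toReal_one]
  rw [mean, ← Finset.sum_mul, hq, one_mul]

theorem mean_sub (q : PMF α) (g h : α → ℝ) :
    mean q (fun a => g a - h a) = mean q g - mean q h := by
  simp only [mean, mul_sub, Finset.sum_sub_distrib]

theorem mean_sum {ι : Type*} (q : PMF α) (s : Finset ι) (g : ι → α → ℝ) :
    mean q (fun a => ∑ i ∈ s, g i a) = ∑ i ∈ s, mean q (g i) := by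
  simp only [mean, Finset.mul_sum]
  exact Finset.sum_comm

theorem mean_mono {q : PMF α} {g h : α → ℝ} (hgh : ∀ a ∈ q.support, g a ≤ h a) :
    mean q g ≤ mean q h := by
  refine Finset.sum_le_sum fun a _ => ?_
  by_cases ha : a ∈ q.support
  · exact mul_le_mul_of_nonneg_left (hgh a ha) ENNReal.toReal_nonneg
  · simp [(q.apply_eq_zero_iff a).2 ha]

theorem mean_nonneg {q : PMF α} {g : α → ℝ} (hg : ∀ a, 0 ≤ g a) : 0 ≤ mean q g :=
  Finset.sum_nonneg fun a _ => mul_nonneg ENNReal.toReal_nonneg (hg a)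

theorem mean_congr {q : PMF α} {g h : α → ℝ} (hgh : ∀ a ∈ q.support, g a = h a) :
    mean q g = mean q h :=
  le_antisymm (mean_mono fun a ha => (hgh a ha).le) (mean_mono fun a ha => (hgh a ha).ge)

theorem mean_bind [Fintype β] (q : PMF α) (r : α → PMF β) (g : β → ℝ) :
    mean (q.bind r) g = mean q fun a => mean (r a) g := by
  simp only [mean, Finset.mul_sum, ← mul_assoc]
  rw [Finset.sum_comm]
  refine Finset.sum_congr rfl fun b _ => ?_
  rw [PMF.bind_apply, tsum_fintype, ENNReal.toReal_sum fun a _ => ENNReal.mul_ne_top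
    (q.apply_ne_top a) ((r a).apply_ne_top b), Finset.sum_mul]
  simp only [ENNReal.toReal_mul]

theorem mean_comm [Fintype β] (q : PMF α) (r : PMF β) (g : α → β → ℝ) :
    mean q (fun a => mean r (g a)) = mean r fun b => mean q fun a => g a b := by
  simp only [mean, Finset.mul_sum]
  rw [Finset.sum_comm]
  simp only [mul_left_comm]

theorem integrable_mean {Ω : Type*} [MeasurableSpace Ω] [DiscreteMeasurableSpace Ω]
    {μ : Measure Ω} (q : Ω → PMF α) {X : α → Ω → ℝ} (hX : ∀ a, Integrable (X a) μ) :
    Integrable (fun ω => mean (q ω) fun a => X a ω) μ := by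
  refine integrable_finsetSum _ fun a _ =>
    (hX a).bdd_mul (c := 1) Measurable.of_discrete.aestronglyMeasurable (.of_forall fun ω => ?_)
  rw [Real.norm_of_nonneg ENNReal.toReal_nonneg]
  exact ENNReal.toReal_mono ENNReal.one_ne_top ((q ω).coe_le_one a)

end Mean

section Restrict

variable [DecidableEq E]

/-- The partial realization obtained by observing the realization `φ` on the items of `D`. -/
def restrict (φ : E → O) (D : Finset E) : PartialRealization E O :=
  fun e => if e ∈ D then some (φ e) else none

theorem restrict_empty (φ : E → O) : restrict φ ∅ = fun _ => none := by
  funext e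
  simp [restrict]

theorem restrict_eq_none_iff {φ : E → O} {D : Finset E} {e : E} :
    restrict φ D e = none ↔ e ∉ D := by
  simp [restrict]

theorem dom_restrict [Fintype E] (φ : E → O) (D : Finset E) : dom (restrict φ D) = D := by
  ext e
  by_cases he : e ∈ D <;> simp [dom, restrict, he]

theorem update_restrict (φ : E → O) (D : Finset E) (e : E) :
    Function.update (restrict φ D) e (some (φ e)) = restrict φ (insert e D) := by
  funext a
  rcases eq_or_ne a e with rfl | hae
  · simp [restrict]
  · simp [restrict, hae]

theorem restrict_eq_restrict_iff {φ φ' : E → O} {D : Finset E} :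
    restrict φ D = restrict φ' D ↔ ∀ e ∈ D, φ e = φ' e := by
  refine ⟨fun h e he => by simpa [restrict, he] using congrFun h e, fun h => funext fun e => ?_⟩
  by_cases he : e ∈ D <;> simp [restrict, he, h]

theorem dependsOn_restrict (D : Finset E) : DependsOn (fun φ : E → O => restrict φ D) D :=
  fun _ _ h => restrict_eq_restrict_iff.2 h

theorem consistent_restrict_iff {φ φ' : E → O} {D : Finset E} :
    Consistent (restrict φ D) φ' ↔ restrict φ' D = restrict φ D := by
  rw [restrict_eq_restrict_iff]
  refine ⟨fun h e he => h e (φ e) (by simp [restrict, he]), fun h e o ho => ?_⟩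
  by_cases he : e ∈ D
  · rw [h e he]
    simpa [restrict, he] using ho
  · simp [restrict, he] at ho

theorem subrealization_restrict (φ : E → O) {D D' : Finset E} (h : D ⊆ D') :
    Subrealization (restrict φ D) (restrict φ D') := by
  intro e o ho
  by_cases he : e ∈ D
  · simpa [restrict, he, h he] using ho
  · simp [restrict, he] at ho

/-- The σ-algebra of the events that are decided by the states of the items in `D`. -/
abbrev observed (D : Finset E) : MeasurableSpace (E → O) :=
  MeasurableSpace.comap (fun φ => restrict φ D) ⊤

theorem measurable_observed_of_dependsOn {α : Type*} [MeasurableSpace α] {D : Finset E}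
    {h : (E → O) → α} (hh : DependsOn h D) : Measurable[observed D] h := by
  have hfactor : h.FactorsThrough fun φ => restrict φ D :=
    fun _ _ hφ => hh (restrict_eq_restrict_iff.1 hφ)
  intro s _
  refine ⟨(fun φ => restrict φ D) '' (h ⁻¹' s), trivial, ?_⟩
  ext φ
  refine ⟨fun ⟨φ', hφ', heq⟩ => ?_, fun hφ => ⟨φ, hφ, rfl⟩⟩
  rwa [Set.mem_preimage, ← hfactor heq]

theorem observed_mono {D D' : Finset E} (h : D ⊆ D') :
    observed D ≤ (observed D' : MeasurableSpace (E → O)) :=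
  letI : MeasurableSpace (PartialRealization E O) := ⊤
  (measurable_observed_of_dependsOn ((dependsOn_restrict D).mono (by exact_mod_cast h))).comap_le

theorem observed_le [MeasurableSpace (E → O)] [DiscreteMeasurableSpace (E → O)] (D : Finset E) :
    observed D ≤ (inferInstance : MeasurableSpace (E → O)) :=
  fun _ _ => .of_discrete

end Restrict

section Marginal

theorem condExp_comap_top_apply {Ω α : Type*} [MeasurableSpace Ω] [DiscreteMeasurableSpace Ω]
    {μ : Measure Ω} [IsFiniteMeasure μ] {X : Ω → ℝ} (hX : Integrable X μ) (r : Ω → α) {ω : Ω}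
    (hω : μ (r ⁻¹' {r ω}) ≠ 0) :
    (μ[X | MeasurableSpace.comap r ⊤]) ω = ⨍ x in r ⁻¹' {r ω}, X x ∂μ := by
  have hle : MeasurableSpace.comap r ⊤ ≤ (inferInstance : MeasurableSpace Ω) :=
    fun _ _ => .of_discrete
  have hconst : Set.EqOn (μ[X | MeasurableSpace.comap r ⊤])
      (fun _ => (μ[X | MeasurableSpace.comap r ⊤]) ω) (r ⁻¹' {r ω}) :=
    fun x hx =>
      (stronglyMeasurable_condExp (m := MeasurableSpace.comap r ⊤)).factorsThrough (mY := ⊤) hx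
  have hfiber := setIntegral_condExp hle hX ⟨{r ω}, trivial, rfl⟩
  rw [setIntegral_congr_fun .of_discrete hconst, setIntegral_const] at hfiber
  rw [setAverage_eq, ← hfiber, smul_smul, inv_mul_cancel₀, one_smul]
  exact (measureReal_ne_zero_iff (measure_ne_top _ _)).2 hω

variable [MeasurableSpace (E → O)] [DiscreteMeasurableSpace (E → O)] {p : PMF (E → O)}
  {f : Finset E → (E → O) → ℝ}

theorem probConsistent_eq_measureReal (p : PMF (E → O)) (ψ : PartialRealization E O) :
    probConsistent p ψ = p.toMeasure.real {φ | Consistent ψ φ} := by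
  rw [probConsistent, measureReal_def, p.toMeasure_apply .of_discrete,
    ENNReal.tsum_toReal_eq fun φ => ?_]
  · refine tsum_congr fun φ => ?_
    by_cases hφ : φ ∈ {φ | Consistent ψ φ} <;> simp [hφ]
  · exact ne_top_of_le_ne_top (p.apply_ne_top φ) (Set.indicator_le_self _ _ φ)

variable [DecidableEq E]

theorem probConsistent_restrict_pos {φ : E → O} (hφ : φ ∈ p.support) (D : Finset E) :
    0 < probConsistent p (restrict φ D) := by
  rw [probConsistent_eq_measureReal, measureReal_def]
  exact ENNReal.toReal_pos (toMeasure_ne_zero_of_mem hφ (consistent_restrict_iff.2 rfl))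
    (measure_ne_top _ _)

variable [Fintype E]

theorem marginal_eq_setAverage (hf : ∀ S, Integrable (f S) p.toMeasure) (e : E)
    (ψ : PartialRealization E O) :
    marginal p f e ψ =
      ⨍ φ in {φ | Consistent ψ φ}, (f (insert e (dom ψ)) φ - f (dom ψ) φ) ∂p.toMeasure := by
  rw [marginal, probConsistent_eq_measureReal, setAverage_eq, smul_eq_mul, div_eq_inv_mul,
    ← integral_indicator .of_discrete, p.integral_eq_tsum]
  · refine congrArg _ (tsum_congr fun φ => ?_)
    by_cases hφ : φ ∈ {φ | Consistent ψ φ} <;> simp [hφ]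
  · exact ((hf _).sub (hf _)).indicator .of_discrete

theorem marginal_restrict_eq_condExp (hf : ∀ S, Integrable (f S) p.toMeasure) (e : E)
    (D : Finset E) {φ : E → O} (hφ : φ ∈ p.support) :
    marginal p f e (restrict φ D) =
      (p.toMeasure[f (insert e D) - f D | observed D]) φ := by
  rw [observed, condExp_comap_top_apply ((hf _).sub (hf _)) _ (toMeasure_ne_zero_of_mem hφ rfl),
    marginal_eq_setAverage hf, dom_restrict]
  simp only [consistent_restrict_iff]
  rfl

theorem integrable_marginal (hf : ∀ S, Integrable (f S) p.toMeasure) (e : E) (D : Finset E) :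
    Integrable (fun φ => marginal p f e (restrict φ D)) p.toMeasure :=
  (integrable_condExp (f := f (insert e D) - f D) (m := observed D)).congr
    (ae_toMeasure_iff.2 fun _ hφ => (marginal_restrict_eq_condExp hf e D hφ).symm)

theorem marginal_restrict_anti (hs : IsAdaptiveSubmodular p f) {φ : E → O} (hφ : φ ∈ p.support)
    {D D' : Finset E} (hD : D ⊆ D') {e : E} (he : e ∉ D') :
    marginal p f e (restrict φ D') ≤ marginal p f e (restrict φ D) :=
  hs _ _ (subrealization_restrict φ hD) (probConsistent_restrict_pos hφ D') e
    (by rwa [dom_restrict])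

end Marginal

section CondNonneg

variable [DecidableEq E] [MeasurableSpace (E → O)]

/-- `X` is integrable and its conditional expectation given the states of the items in `D` is
almost surely nonnegative: the form in which adaptive procedures are compared. -/
def CondNonneg (μ : Measure (E → O)) (D : Finset E) (X : (E → O) → ℝ) : Prop :=
  Integrable X μ ∧ 0 ≤ᵐ[μ] μ[X | observed D]

namespace CondNonneg

variable {μ : Measure (E → O)} {D D' : Finset E} {X Y : (E → O) → ℝ}

theorem of_nonneg (hX : Integrable X μ) (h : 0 ≤ᵐ[μ] X) : CondNonneg μ D X :=
  ⟨hX, condExp_nonneg h⟩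

theorem zero (μ : Measure (E → O)) (D : Finset E) : CondNonneg μ D fun _ => 0 :=
  of_nonneg (integrable_zero _ _ _) (.of_forall fun _ => le_rfl)

theorem add (hX : CondNonneg μ D X) (hY : CondNonneg μ D Y) :
    CondNonneg μ D fun φ => X φ + Y φ := by
  refine ⟨hX.1.add hY.1, ?_⟩
  filter_upwards [hX.2, hY.2, condExp_add hX.1 hY.1 (observed D)] with φ hXφ hYφ hadd
  exact (add_nonneg hXφ hYφ).trans_eq hadd.symm

theorem sum {ι : Type*} {s : Finset ι} {X : ι → (E → O) → ℝ}
    (hX : ∀ i ∈ s, CondNonneg μ D (X i)) : CondNonneg μ D fun φ => ∑ i ∈ s, X i φ := by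
  classical
  induction s using Finset.induction_on with
  | empty => simpa using zero μ D
  | insert i s hi ih =>
    simp only [Finset.sum_insert hi]
    exact (hX i (Finset.mem_insert_self i s)).add
      (ih fun j hj => hX j (Finset.mem_insert_of_mem hj))

variable [DiscreteMeasurableSpace (E → O)] [IsFiniteMeasure μ]

theorem integral_nonneg (hX : CondNonneg μ D X) : 0 ≤ ∫ φ, X φ ∂μ := by
  rw [← integral_condExp (observed_le D)]
  exact integral_nonneg_of_ae hX.2

theorem mono (hX : CondNonneg μ D' X) (h : D ⊆ D') : CondNonneg μ D X := by
  refine ⟨hX.1, ?_⟩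
  have htower := condExp_condExp_of_le (f := X) (μ := μ) (observed_mono h) (observed_le D')
  exact (condExp_nonneg hX.2).trans_eq htower

theorem weight_mul {w : (E → O) → ℝ} (hw : DependsOn w D) (h0 : ∀ φ, 0 ≤ w φ)
    (h1 : ∀ φ, w φ ≤ 1) (hX : CondNonneg μ D X) : CondNonneg μ D fun φ => w φ * X φ := by
  have hbound : ∀ᵐ φ ∂μ, ‖w φ‖ ≤ 1 :=
    .of_forall fun φ => (Real.norm_of_nonneg (h0 φ)).trans_le (h1 φ)
  refine ⟨hX.1.bdd_mul Measurable.of_discrete.aestronglyMeasurable hbound, ?_⟩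
  filter_upwards [hX.2, condExp_stronglyMeasurable_mul_of_bound (observed_le D)
    (measurable_observed_of_dependsOn hw).stronglyMeasurable hX.1 1 hbound] with φ hφ hmul
  exact (mul_nonneg (h0 φ) hφ).trans_eq hmul.symm

/-- The term of `i` is first conditioned on the states of the items in `D' i`, which determine the
probability of `i`; the tower property then brings all terms back to `D`. -/
theorem mean {ι : Type*} [Fintype ι] {q : (E → O) → PMF ι} {D' : ι → Finset E}
    {X : ι → (E → O) → ℝ} (hD : ∀ i, D ⊆ D' i) (hq : ∀ i, DependsOn (fun φ => q φ i) (D' i))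
    (hX : ∀ φ, ∀ i ∈ (q φ).support, CondNonneg μ (D' i) (X i)) :
    CondNonneg μ D fun φ => mean (q φ) fun i => X i φ := by
  refine sum fun i _ => ?_
  by_cases hi : ∃ φ, i ∈ (q φ).support
  · obtain ⟨φ, hφ⟩ := hi
    exact ((hX φ i hφ).weight_mul (fun _ _ h => congrArg ENNReal.toReal (hq i h))
      (fun _ => ENNReal.toReal_nonneg)
      fun φ => ENNReal.toReal_mono ENNReal.one_ne_top ((q φ).coe_le_one i)).mono (hD i)
  · have hzero (φ : E → O) : q φ i = 0 := by_contra fun h => hi ⟨φ, h⟩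
    simpa only [hzero, ENNReal.toReal_zero, zero_mul] using zero μ D

end CondNonneg

end CondNonneg

section Gains

variable [Fintype E] [DecidableEq E]
  [MeasurableSpace (E → O)] [DiscreteMeasurableSpace (E → O)]
  {p : PMF (E → O)} {f : Finset E → (E → O) → ℝ}

theorem condExp_gain_sub_marginal (hf : ∀ S, Integrable (f S) p.toMeasure) (e : E)
    (D : Finset E) :
    p.toMeasure[fun φ => f (insert e D) φ - f D φ - marginal p f e (restrict φ D) | observed D]
      =ᵐ[p.toMeasure] 0 := by
  have hmarginal : StronglyMeasurable[observed D] fun φ => marginal p f e (restrict φ D) :=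
    (measurable_observed_of_dependsOn fun _ _ h =>
      congrArg (marginal p f e) (dependsOn_restrict D h)).stronglyMeasurable
  filter_upwards [condExp_sub ((hf (insert e D)).sub (hf D)) (integrable_marginal hf e D)
      (observed D), ae_toMeasure_iff.2 fun φ hφ => marginal_restrict_eq_condExp hf e D hφ]
    with φ hsub hφ
  refine hsub.trans ?_
  rw [Pi.sub_apply, condExp_of_stronglyMeasurable (observed_le D) hmarginal
    (integrable_marginal hf e D)]
  exact sub_eq_zero.2 hφ.symm

theorem condNonneg_gain_sub_marginal (hf : ∀ S, Integrable (f S) p.toMeasure) (e : E)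
    (D : Finset E) : CondNonneg p.toMeasure D fun φ =>
      f (insert e D) φ - f D φ - marginal p f e (restrict φ D) :=
  ⟨((hf _).sub (hf _)).sub (integrable_marginal hf e D),
    (condExp_gain_sub_marginal hf e D).symm.le⟩

theorem condNonneg_marginal_sub_gain (hf : ∀ S, Integrable (f S) p.toMeasure)
    (hs : IsAdaptiveSubmodular p f) {e : E} {D D' : Finset E} (hD : D ⊆ D') (he : e ∉ D') :
    CondNonneg p.toMeasure D' fun φ =>
      marginal p f e (restrict φ D) - (f (insert e D') φ - f D' φ) := by
  have hsame : CondNonneg p.toMeasure D' fun φ =>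
      marginal p f e (restrict φ D') - (f (insert e D') φ - f D' φ) := by
    refine ⟨(integrable_marginal hf e D').sub ((hf _).sub (hf _)), ?_⟩
    filter_upwards [condExp_gain_sub_marginal hf e D', condExp_neg
      (fun φ => f (insert e D') φ - f D' φ - marginal p f e (restrict φ D')) (observed D')]
      with φ hzero hneg
    simp only [Pi.neg_def, neg_sub] at hneg
    rw [hneg, hzero, Pi.zero_apply, neg_zero]
  have hanti : CondNonneg p.toMeasure D' fun φ =>
      marginal p f e (restrict φ D) - marginal p f e (restrict φ D') :=
    .of_nonneg ((integrable_marginal hf e D).sub (integrable_marginal hf e D'))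
      (ae_toMeasure_iff.2 fun _ hφ => sub_nonneg.2 (marginal_restrict_anti hs hφ hD he))
  simpa only [sub_add_sub_cancel] using hanti.add hsame

end Gains

section Policies

/-- A random set of items, depending on the realization, is adapted if the probability of each
outcome `T` is determined by the states of the items in `T`; this is what remains of a policy
when only its selected set is kept. -/
def IsAdapted (q : (E → O) → PMF (Finset E)) : Prop :=
  ∀ T : Finset E, DependsOn (fun φ => q φ T) T

theorem IsAdapted.dependsOn {q : (E → O) → PMF (Finset E)} (hq : IsAdapted q) {C D : Finset E}
    (h : C ⊆ D) : DependsOn (fun φ => q φ C) D :=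
  (hq C).mono (Finset.coe_subset.2 h)

namespace Policy

variable [DecidableEq E]

theorem notMem_of_mem_support {π : Policy E O} {φ : E → O} {D : Finset E} {e : E}
    (he : some e ∈ (π.next (restrict φ D)).support) : e ∉ D :=
  restrict_eq_none_iff.1 (π.fresh _ e he)

variable [Fintype E]

/-- The law of the set of items selected within `n` steps of `π` under `φ`, starting with the items
of `D` already selected. -/
def selectedFrom (π : Policy E O) (φ : E → O) (n : ℕ) (D : Finset E) : PMF (Finset E) :=
  (π.run φ n (restrict φ D)).map dom

theorem selected_eq_selectedFrom (π : Policy E O) (φ : E → O) :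
    π.selected φ = π.selectedFrom φ (Fintype.card E) ∅ := by
  rw [selectedFrom, restrict_empty, selected]

theorem selectedFrom_zero (π : Policy E O) (φ : E → O) (D : Finset E) :
    π.selectedFrom φ 0 D = PMF.pure D := by
  rw [selectedFrom, run, PMF.pure_map, dom_restrict]

theorem selectedFrom_succ (π : Policy E O) (φ : E → O) (n : ℕ) (D : Finset E) :
    π.selectedFrom φ (n + 1) D = (π.next (restrict φ D)).bind fun a =>
      a.elim (PMF.pure D) fun e => π.selectedFrom φ n (insert e D) := by
  rw [selectedFrom, run, PMF.map_bind]
  congr 1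
  funext a
  cases a with
  | none => simp only [PMF.pure_map, dom_restrict, Option.elim_none]
  | some e => simp only [update_restrict, selectedFrom, Option.elim_some]

theorem selectedFrom_induction {π : Policy E O} {φ : E → O} {P : Finset E → Prop}
    (hstep : ∀ D e, P D → some e ∈ (π.next (restrict φ D)).support → P (insert e D)) (n : ℕ)
    {D : Finset E} (hD : P D) : ∀ T ∈ (π.selectedFrom φ n D).support, P T := by
  induction n generalizing D with
  | zero => simpa [selectedFrom_zero] using hD
  | succ n ih =>
    intro T hT
    rw [selectedFrom_succ, PMF.mem_support_bind_iff] at hT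
    obtain ⟨_ | e, ha, hT⟩ := hT
    · rwa [show T = D by simpa using hT]
    · exact ih (hstep D e hD ha) T hT

theorem subset_of_mem_support_selectedFrom {π : Policy E O} {φ : E → O} {n : ℕ}
    {D T : Finset E} (hT : T ∈ (π.selectedFrom φ n D).support) : D ⊆ T :=
  selectedFrom_induction (P := (D ⊆ ·)) (fun _ e h _ => h.trans (Finset.subset_insert e _)) n
    subset_rfl T hT

theorem isAdapted_selectedFrom (π : Policy E O) (n : ℕ) (D : Finset E) :
    IsAdapted fun φ => π.selectedFrom φ n D := by
  intro T φ φ' h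
  induction n generalizing D with
  | zero => simp only [selectedFrom_zero]
  | succ n ih =>
    by_cases hDT : D ⊆ T
    · have hnext := restrict_eq_restrict_iff.2 fun e he => h e (hDT he)
      simp only [selectedFrom_succ, PMF.bind_apply, hnext]
      refine tsum_congr fun a => congrArg _ ?_
      cases a with
      | none => rfl
      | some e => exact ih (insert e D)
    · have hzero (φ : E → O) : π.selectedFrom φ (n + 1) D T = 0 :=
        (PMF.apply_eq_zero_iff _ _).2 fun hT => hDT (subset_of_mem_support_selectedFrom hT)
      simp only [hzero]

theorem isAdapted_selected (π : Policy E O) : IsAdapted π.selected := by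
  rw [funext π.selected_eq_selectedFrom]
  exact π.isAdapted_selectedFrom _ ∅

variable [MeasurableSpace (E → O)] [DiscreteMeasurableSpace (E → O)] {μ : Measure (E → O)}
  [IsFiniteMeasure μ]

theorem condNonneg_sub_mean_selectedFrom {π : Policy E O} {u : Finset E → (E → O) → ℝ}
    (hstep : ∀ D φ e, some e ∈ (π.next (restrict φ D)).support →
      CondNonneg μ D fun φ => u D φ - u (insert e D) φ) (n : ℕ) (D : Finset E) :
    CondNonneg μ D fun φ => u D φ - mean (π.selectedFrom φ n D) fun T => u T φ := by
  induction n generalizing D with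
  | zero => simpa only [selectedFrom_zero, mean_pure, sub_self] using .zero μ D
  | succ n ih =>
    have hdecomp (φ : E → O) :
        u D φ - mean (π.selectedFrom φ (n + 1) D) (fun T => u T φ) =
          mean (π.next (restrict φ D)) fun a => a.elim 0 fun e => (u D φ - u (insert e D) φ) +
            (u (insert e D) φ - mean (π.selectedFrom φ n (insert e D)) fun T => u T φ) := by
      rw [selectedFrom_succ, mean_bind, ← mean_const (π.next (restrict φ D)) (u D φ), ← mean_sub]
      refine mean_congr fun a _ => ?_
      cases a <;> simp [mean_pure, mean_const]
    simp only [hdecomp]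
    refine CondNonneg.mean (D' := fun _ => D)
      (X := fun (a : Option E) φ => a.elim 0 fun e => (u D φ - u (insert e D) φ) +
        (u (insert e D) φ - mean (π.selectedFrom φ n (insert e D)) fun T => u T φ))
      (fun _ => subset_rfl) ?_ ?_
    · exact fun a φ φ' h => congrArg (fun ψ => π.next ψ a) (dependsOn_restrict D h)
    · rintro φ (_ | e) ha
      · exact .zero μ D
      · exact (hstep D φ e ha).add ((ih (insert e D)).mono (Finset.subset_insert e D))

end Policy

end Policies

section Unions

variable [Fintype E] [DecidableEq E]
  [MeasurableSpace (E → O)] [DiscreteMeasurableSpace (E → O)]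
  {p : PMF (E → O)} {f : Finset E → (E → O) → ℝ} {q r : (E → O) → PMF (Finset E)}

theorem Policy.integral_mean_selected_le {μ : Measure (E → O)} [IsFiniteMeasure μ]
    {π : Policy E O} {u : Finset E → (E → O) → ℝ} (hu : ∀ D, Integrable (u D) μ)
    (hstep : ∀ D φ e, some e ∈ (π.next (restrict φ D)).support →
      CondNonneg μ D fun φ => u D φ - u (insert e D) φ) :
    ∫ φ, mean (π.selected φ) (fun T => u T φ) ∂μ ≤ ∫ φ, u ∅ φ ∂μ := by
  have h := (condNonneg_sub_mean_selectedFrom hstep (Fintype.card E) ∅).integral_nonneg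
  simp only [← selected_eq_selectedFrom] at h
  rwa [integral_sub (hu ∅) (integrable_mean _ hu), sub_nonneg] at h

theorem integral_union_sub_marginal_le (hf : ∀ S, Integrable (f S) p.toMeasure)
    (hs : IsAdaptiveSubmodular p f) (hq : IsAdapted q) (π : Policy E O) :
    ∫ φ, mean (π.selected φ) (fun T => mean (q φ) fun C =>
        f (T ∪ C) φ - ∑ e ∈ T \ C, marginal p f e (restrict φ C)) ∂p.toMeasure ≤
      ∫ φ, mean (q φ) (fun C => f C φ) ∂p.toMeasure := by
  have hu (D C : Finset E) : Integrable (fun φ =>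
      f (D ∪ C) φ - ∑ e ∈ D \ C, marginal p f e (restrict φ C)) p.toMeasure :=
    (hf _).sub (integrable_finsetSum _ fun e _ => integrable_marginal hf e C)
  refine (π.integral_mean_selected_le (fun D => integrable_mean q (hu D)) ?_).trans_eq
    (by simp)
  intro D φ₀ e he
  simp only [← mean_sub]
  refine CondNonneg.mean (D' := fun C => D ∪ C) (fun _ => Finset.subset_union_left)
    (fun C => hq.dependsOn Finset.subset_union_right) fun _ C _ => ?_
  by_cases heC : e ∈ C
  · simpa [Finset.insert_union, Finset.insert_eq_of_mem (Finset.mem_union_right D heC),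
      Finset.insert_sdiff_of_mem D heC] using CondNonneg.zero _ _
  · have heD : e ∉ D := π.notMem_of_mem_support he
    convert condNonneg_marginal_sub_gain hf hs (Finset.subset_union_right (s₁ := D) (s₂ := C))
      (show e ∉ D ∪ C by simp [heC, heD]) using 2 with φ
    rw [Finset.insert_sdiff_of_notMem D heC, Finset.sum_insert (by simp [heD]),
      Finset.insert_union]
    ring

theorem condNonneg_gain_sub_mean_gain (hf : ∀ S, Integrable (f S) p.toMeasure)
    (hs : IsAdaptiveSubmodular p f) (hq : IsAdapted q) {D : Finset E} {e : E} (heD : e ∉ D)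
    (heC : ∀ φ, ∀ C ∈ (q φ).support, e ∉ C) :
    CondNonneg p.toMeasure D fun φ => f (insert e D) φ - f D φ -
      mean (q φ) fun C => f (insert e (D ∪ C)) φ - f (D ∪ C) φ := by
  have hlarger : CondNonneg p.toMeasure D fun φ => mean (q φ) fun C =>
      marginal p f e (restrict φ D) - (f (insert e (D ∪ C)) φ - f (D ∪ C) φ) :=
    .mean (D' := fun C => D ∪ C) (fun _ => Finset.subset_union_left)
      (fun C => hq.dependsOn Finset.subset_union_right) fun φ C hC =>
        condNonneg_marginal_sub_gain hf hs Finset.subset_union_left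
          (by simp [heD, heC φ C hC])
  simpa only [mean_sub _ (fun _ => marginal p f e _), mean_const, sub_add_sub_cancel]
    using (condNonneg_gain_sub_marginal hf e D).add hlarger

theorem integral_selected_union_gain_le (hf : ∀ S, Integrable (f S) p.toMeasure)
    (hs : IsAdaptiveSubmodular p f) (hq : IsAdapted q) (hr : IsAdapted r) {π : Policy E O}
    (hdisj : ∀ ψ e, some e ∈ (π.next ψ).support → ∀ φ, ∀ C ∈ (r φ).support, e ∉ C) :
    ∫ φ, mean (π.selected φ) (fun D => mean (q φ) fun T => mean (r φ) fun C =>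
        f (T ∪ D ∪ C) φ - f (T ∪ D) φ) ∂p.toMeasure ≤
      ∫ φ, mean (q φ) (fun T => mean (r φ) fun C => f (T ∪ C) φ - f T φ) ∂p.toMeasure := by
  have hu (D : Finset E) : Integrable (fun φ => mean (q φ) fun T => mean (r φ) fun C =>
      f (T ∪ D ∪ C) φ - f (T ∪ D) φ) p.toMeasure :=
    integrable_mean q fun T => integrable_mean r fun C => (hf _).sub (hf _)
  refine (π.integral_mean_selected_le hu fun D φ₀ e he => ?_).trans_eq
    (by simp only [Finset.union_empty])
  simp only [← mean_sub]
  refine CondNonneg.mean (D' := fun T => T ∪ D) (fun _ => Finset.subset_union_right)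
    (fun T => hq.dependsOn Finset.subset_union_left) fun _ T _ => ?_
  by_cases heT : e ∈ T
  · simpa [Finset.union_insert, Finset.insert_eq_of_mem, heT, mean_const]
      using CondNonneg.zero _ _
  · have heD : e ∉ D := π.notMem_of_mem_support he
    convert condNonneg_gain_sub_mean_gain hf hs hr (D := T ∪ D) (e := e) (by simp [heT, heD])
      (hdisj _ e he) using 2 with φ
    simp only [Finset.union_insert, Finset.insert_union, mean_sub, mean_const]
    ring

theorem integral_le_integral_union_add_integral_union (hf : ∀ S, Integrable (f S) p.toMeasure)
    (h0 : ∀ S φ, 0 ≤ f S φ) (hs : IsAdaptiveSubmodular p f) (hq : IsAdapted q)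
    (hr : IsAdapted r) {π : Policy E O}
    (hdisj : ∀ ψ e, some e ∈ (π.next ψ).support → ∀ φ, ∀ C ∈ (r φ).support, e ∉ C) :
    ∫ φ, mean (q φ) (fun T => f T φ) ∂p.toMeasure ≤
      ∫ φ, mean (q φ) (fun T => mean (π.selected φ) fun D => f (T ∪ D) φ) ∂p.toMeasure +
        ∫ φ, mean (q φ) (fun T => mean (r φ) fun C => f (T ∪ C) φ) ∂p.toMeasure := by
  have hlast : -∫ φ, mean (q φ) (fun T => mean (π.selected φ) fun D => f (T ∪ D) φ)
      ∂p.toMeasure ≤ ∫ φ, mean (π.selected φ) (fun D => mean (q φ) fun T =>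
        mean (r φ) fun C => f (T ∪ D ∪ C) φ - f (T ∪ D) φ) ∂p.toMeasure := by
    rw [← integral_neg]
    refine integral_mono
      (integrable_mean q fun T => integrable_mean π.selected fun D => hf _).neg
      (integrable_mean π.selected fun D => integrable_mean q fun T => integrable_mean r fun C =>
        (hf _).sub (hf _)) fun φ => ?_
    have hunion_nonneg : 0 ≤ mean (π.selected φ) fun D => mean (q φ) fun T =>
        mean (r φ) fun C => f (T ∪ D ∪ C) φ :=
      mean_nonneg fun D => mean_nonneg fun T => mean_nonneg fun C => h0 _ φ
    simpa only [mean_sub, mean_const, mean_comm (q φ), neg_le_sub_iff_le_add,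
      le_add_iff_nonneg_left] using hunion_nonneg
  have hfirst : ∫ φ, mean (q φ) (fun T => mean (r φ) fun C => f (T ∪ C) φ - f T φ)
      ∂p.toMeasure =
      ∫ φ, mean (q φ) (fun T => mean (r φ) fun C => f (T ∪ C) φ) ∂p.toMeasure -
        ∫ φ, mean (q φ) (fun T => f T φ) ∂p.toMeasure := by
    rw [← integral_sub (integrable_mean q fun T => integrable_mean r fun C => hf _)
      (integrable_mean q hf)]
    simp only [mean_sub, mean_const]
  linarith [integral_selected_union_gain_le hf hs hq hr hdisj]

end Unions

section IndependenceSystems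

variable {I : Set (Finset E)}

theorem exists_isBaseOf_superset [Finite E] {R U : Finset E} (hU : U ∈ I) (hUR : U ⊆ R) :
    ∃ B, IsBaseOf I R B ∧ U ⊆ B := by
  obtain ⟨B, hUB, hB⟩ := (Set.toFinite {A : Finset E | A ∈ I ∧ A ⊆ R}).exists_le_maximal
    (show U ∈ {A : Finset E | A ∈ I ∧ A ⊆ R} from ⟨hU, hUR⟩)
  exact ⟨B, ⟨hB.prop, fun A hA hAR hBA => hB.eq_of_le ⟨hA, hAR⟩ hBA⟩, hUB⟩

theorem IsKSystem.card_le_of_insert_notMem [Finite E] [DecidableEq E] {k : ℕ}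
    (hI : IsKSystem I k) {D U : Finset E} (hD : D ∈ I) (hU : U ∈ I)
    (h : ∀ t ∈ U, t ∉ D → insert t D ∉ I) : U.card ≤ k * D.card := by
  obtain ⟨B, hB, hUB⟩ := exists_isBaseOf_superset hU (Finset.subset_union_right (s₁ := D))
  refine (Finset.card_le_card hUB).trans (hI.2.2 (D ∪ U) B D hB ⟨⟨hD, Finset.subset_union_left⟩,
    fun A hA hAR hDA => hDA.antisymm fun t ht => ?_⟩)
  by_contra htD
  have htU : t ∈ U := (Finset.mem_union.1 (hAR ht)).resolve_left htD
  exact h t htU htD (hI.1.2 A hA _ (Finset.insert_subset ht hDA))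

end IndependenceSystems

theorem sum_comp_le_mul_sum_range {ι : Type*} {s : Finset ι} {j : ι → ℕ} {d : ℕ → ℝ} {k m : ℕ}
    (hd : Antitone d) (h0 : ∀ i, 0 ≤ d i) (hj : ∀ t ∈ s, j t < m)
    (hcount : ∀ i, (s.filter fun t => j t < i).card ≤ k * i) :
    ∑ t ∈ s, d (j t) ≤ k * ∑ i ∈ Finset.range m, d i := by
  have htruncated (n : ℕ) :
      ∑ t ∈ s, (d (min (j t) n) - d n) + k * n * d n ≤ k * ∑ i ∈ Finset.range n, d i := by
    induction n with
    | zero => simp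
    | succ n ih =>
      have hterm (t : ι) : d (min (j t) (n + 1)) - d (n + 1) =
          d (min (j t) n) - d n + if j t < n + 1 then d n - d (n + 1) else 0 := by
        split_ifs with h
        · rw [min_eq_left h.le, min_eq_left (Nat.lt_succ_iff.1 h)]; ring
        · rw [min_eq_right (not_lt.1 h), min_eq_right (by omega)]; ring
      have hn : ((s.filter fun t => j t < n + 1).card : ℝ) ≤ k * (n + 1) := by
        exact_mod_cast hcount (n + 1)
      have hmul := mul_le_mul_of_nonneg_right hn (sub_nonneg.2 (hd n.le_succ))
      simp only [hterm, Finset.sum_add_distrib, ← Finset.sum_filter, Finset.sum_const,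
        nsmul_eq_mul, Finset.sum_range_succ, Nat.succ_eq_add_one, Nat.cast_add,
        Nat.cast_one] at hmul ⊢
      linarith
  have hcard : (s.card : ℝ) ≤ k * m := by
    have h := hcount m
    rw [Finset.filter_true_of_mem hj] at h
    exact_mod_cast h
  have hm := htruncated m
  rw [Finset.sum_congr rfl fun t ht => by rw [min_eq_left (hj t ht).le], Finset.sum_sub_distrib,
    Finset.sum_const, nsmul_eq_mul] at hm
  linarith [mul_le_mul_of_nonneg_right hcard (h0 m)]

section GreedyRules

variable [DecidableEq E]

/-- The set selected in the first `i` steps of the deterministic rule `next`, which maps the set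
selected so far to the next item, or to `none` in order to stop. -/
def stage (next : Finset E → Option E) : ℕ → Finset E
  | 0 => ∅
  | i + 1 => (next (stage next i)).elim (stage next i) fun e => insert e (stage next i)

/-- The weight `w e D` of the item `e` selected at step `i` on top of `D = stage next i`, or `0` if
no new item is selected at that step. -/
def stepGain (w : E → Finset E → ℝ) (next : Finset E → Option E) (i : ℕ) : ℝ :=
  ∑ e ∈ stage next (i + 1) \ stage next i, w e (stage next i)

/-- The set selected once `next` has stopped, for a rule that selects new items only. -/
def finalStage [Fintype E] (next : Finset E → Option E) : Finset E :=
  stage next (Fintype.card E)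

/-- The total weight of the items selected by `next`, each weighed when it is selected. -/
def totalGain [Fintype E] (w : E → Finset E → ℝ) (next : Finset E → Option E) : ℝ :=
  ∑ i ∈ Finset.range (Fintype.card E), stepGain w next i

/-- The share of the item `e` in the total gain. -/
def itemGain [Fintype E] (w : E → Finset E → ℝ) (next : Finset E → Option E) (e : E) : ℝ :=
  ∑ i ∈ Finset.range (Fintype.card E),
    if e ∈ stage next (i + 1) \ stage next i then w e (stage next i) else 0

variable {next : Finset E → Option E} {w : E → Finset E → ℝ} {i n : ℕ} {e : E}

theorem stage_succ_of_none (h : next (stage next i) = none) :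
    stage next (i + 1) = stage next i := by
  rw [stage, h, Option.elim_none]

theorem stage_succ_of_some (h : next (stage next i) = some e) :
    stage next (i + 1) = insert e (stage next i) := by
  rw [stage, h, Option.elim_some]

theorem stage_add_of_none (h : next (stage next i) = none) (n : ℕ) :
    stage next (i + n) = stage next i := by
  induction n with
  | zero => rfl
  | succ n ih => rw [← add_assoc, stage_succ_of_none (ih ▸ h), ih]

theorem stepGain_of_none (h : next (stage next i) = none) : stepGain w next i = 0 := by
  rw [stepGain, stage_succ_of_none h, Finset.sdiff_self, Finset.sum_empty]

theorem stepGain_of_some (h : next (stage next i) = some e) (he : e ∉ stage next i) :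
    stepGain w next i = w e (stage next i) := by
  rw [stepGain, stage_succ_of_some h, Finset.insert_sdiff_of_notMem _ he, Finset.sdiff_self,
    insert_empty_eq, Finset.sum_singleton]

theorem next_eq_some_of_mem_sdiff (h : e ∈ stage next (i + 1) \ stage next i) :
    next (stage next i) = some e := by
  rw [Finset.mem_sdiff] at h
  cases hnext : next (stage next i) with
  | none => rw [stage_succ_of_none hnext] at h; exact absurd h.1 h.2
  | some a =>
    rw [stage_succ_of_some hnext, Finset.mem_insert] at h
    rw [h.1.resolve_right h.2]

theorem stage_mono (next : Finset E → Option E) : Monotone (stage next) := by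
  refine monotone_nat_of_le_succ fun i => ?_
  cases h : next (stage next i) with
  | none => rw [stage_succ_of_none h]
  | some e => rw [stage_succ_of_some h]; exact Finset.subset_insert _ _

theorem card_stage_le (next : Finset E → Option E) (i : ℕ) : (stage next i).card ≤ i := by
  induction i with
  | zero => simp [stage]
  | succ i ih =>
    cases h : next (stage next i) with
    | none => rw [stage_succ_of_none h]; exact ih.trans i.le_succ
    | some e =>
      rw [stage_succ_of_some h]
      exact (Finset.card_insert_le _ _).trans (Nat.succ_le_succ ih)

theorem exists_mem_stage_succ_sdiff (h : e ∈ stage next n) :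
    ∃ i < n, e ∈ stage next (i + 1) \ stage next i := by
  induction n with
  | zero => simp [stage] at h
  | succ n ih =>
    by_cases hn : e ∈ stage next n
    · obtain ⟨i, hi, hstep⟩ := ih hn
      exact ⟨i, hi.trans n.lt_succ_self, hstep⟩
    · exact ⟨n, n.lt_succ_self, Finset.mem_sdiff.2 ⟨h, hn⟩⟩

theorem sum_itemGain [Fintype E] (w : E → Finset E → ℝ) {S : Finset E}
    (hS : finalStage next ⊆ S) :
    ∑ e ∈ S, itemGain w next e = totalGain w next := by
  simp only [itemGain, totalGain, stepGain]
  rw [Finset.sum_comm]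
  refine Finset.sum_congr rfl fun i hi => ?_
  have hsub : stage next (i + 1) \ stage next i ⊆ S :=
    Finset.sdiff_subset.trans ((stage_mono next (Finset.mem_range.1 hi)).trans hS)
  rw [← Finset.sum_filter, Finset.filter_mem_eq_inter, Finset.inter_eq_right.2 hsub]

theorem totalGain_sub [Fintype E] (w w' : E → Finset E → ℝ) (next : Finset E → Option E) :
    totalGain (fun e D => w e D - w' e D) next = totalGain w next - totalGain w' next := by
  simp only [totalGain, stepGain, Finset.sum_sub_distrib]

theorem stepGain_eq_mean [Fintype E] (hnew : ∀ {D e}, next D = some e → e ∉ D) :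
    stepGain w next i = mean (PMF.pure (stage next i)) fun D =>
      mean (PMF.pure (next D)) fun a => a.elim 0 fun e => w e D := by
  rw [mean_pure, mean_pure]
  cases h : next (stage next i) with
  | none => rw [stepGain_of_none h, Option.elim_none]
  | some e => rw [stepGain_of_some h (hnew h), Option.elim_some]

theorem totalGain_increment [Fintype E] (hnew : ∀ {D e}, next D = some e → e ∉ D)
    (g : Finset E → ℝ) :
    totalGain (fun e D => g (insert e D) - g D) next = g (finalStage next) - g ∅ := by
  have hstep (i : ℕ) : stepGain (fun e D => g (insert e D) - g D) next i =
      g (stage next (i + 1)) - g (stage next i) := by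
    cases h : next (stage next i) with
    | none => rw [stepGain_of_none h, stage_succ_of_none h, sub_self]
    | some e => rw [stepGain_of_some h (hnew h), stage_succ_of_some h]
  simp only [totalGain, hstep]
  exact Finset.sum_range_sub (fun i => g (stage next i)) _

/-- The rule `next` always selects an item of `S` of largest weight among those that are new, keep
the selection independent, and have positive weight; it stops only if there is none. -/
structure IsGreedy (I : Set (Finset E)) (w : E → Finset E → ℝ) (S : Finset E)
    (next : Finset E → Option E) : Prop where
  mem : ∀ {D e}, next D = some e → e ∈ S
  notMem : ∀ {D e}, next D = some e → e ∉ D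
  insert_mem : ∀ {D e}, next D = some e → insert e D ∈ I
  pos : ∀ {D e}, next D = some e → 0 < w e D
  exists_le : ∀ {D t}, t ∈ S → t ∉ D → insert t D ∈ I → 0 < w t D →
    ∃ e, next D = some e ∧ w t D ≤ w e D

/-- The weight of an item decreases along the growing selection, as long as it is unselected. -/
def HasDiminishingGains (w : E → Finset E → ℝ) : Prop :=
  ∀ ⦃D D'⦄, D ⊆ D' → ∀ e ∉ D', w e D' ≤ w e D

namespace IsGreedy

variable {I : Set (Finset E)} {S : Finset E} (h : IsGreedy I w S next)

include h

theorem stage_subset (i : ℕ) : stage next i ⊆ S := by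
  induction i with
  | zero => exact Finset.empty_subset S
  | succ i ih =>
    cases hnext : next (stage next i) with
    | none => rwa [stage_succ_of_none hnext]
    | some e => rw [stage_succ_of_some hnext]; exact Finset.insert_subset (h.mem hnext) ih

theorem stage_mem (hI : ∅ ∈ I) (i : ℕ) : stage next i ∈ I := by
  induction i with
  | zero => exact hI
  | succ i ih =>
    cases hnext : next (stage next i) with
    | none => rwa [stage_succ_of_none hnext]
    | some e => rw [stage_succ_of_some hnext]; exact h.insert_mem hnext

theorem card_stage_of_some (he : next (stage next i) = some e) : (stage next i).card = i := by
  induction i generalizing e with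
  | zero => rfl
  | succ i ih =>
    cases hnext : next (stage next i) with
    | none => rw [stage_succ_of_none hnext, hnext] at he; contradiction
    | some a =>
      rw [stage_succ_of_some hnext, Finset.card_insert_of_notMem (h.notMem hnext), ih hnext]

theorem next_finalStage [Fintype E] : next (finalStage next) = none := by
  rw [Option.eq_none_iff_forall_ne_some]
  intro e he
  have huniv := (Finset.card_eq_iff_eq_univ _).1 (h.card_stage_of_some he)
  exact h.notMem he (by rw [finalStage, huniv]; exact Finset.mem_univ e)

theorem stepGain_nonneg (i : ℕ) : 0 ≤ stepGain w next i := by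
  cases hnext : next (stage next i) with
  | none => rw [stepGain_of_none hnext]
  | some e => rw [stepGain_of_some hnext (h.notMem hnext)]; exact (h.pos hnext).le

theorem le_stepGain {t : E} (htS : t ∈ S) (ht : t ∉ stage next i)
    (htI : insert t (stage next i) ∈ I) : w t (stage next i) ≤ stepGain w next i := by
  rcases le_or_gt (w t (stage next i)) 0 with hw | hw
  · exact hw.trans (h.stepGain_nonneg i)
  · obtain ⟨e, he, hle⟩ := h.exists_le htS ht htI hw
    rwa [stepGain_of_some he (h.notMem he)]

theorem stepGain_antitone (hI : IsIndependenceSystem I) (hw : HasDiminishingGains w) :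
    Antitone (stepGain w next) := by
  refine antitone_nat_of_succ_le fun i => ?_
  cases hnext : next (stage next (i + 1)) with
  | none => rw [stepGain_of_none hnext]; exact h.stepGain_nonneg i
  | some e =>
    have hsub : stage next i ⊆ stage next (i + 1) := stage_mono next i.le_succ
    rw [stepGain_of_some hnext (h.notMem hnext)]
    exact (hw hsub e (h.notMem hnext)).trans (h.le_stepGain (h.mem hnext)
      (fun he => h.notMem hnext (hsub he))
      (hI.2 _ (h.insert_mem hnext) _ (Finset.insert_subset_insert e hsub)))

theorem ite_weight_nonneg (e : E) (i : ℕ) :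
    0 ≤ if e ∈ stage next (i + 1) \ stage next i then w e (stage next i) else 0 := by
  split_ifs with he
  · exact (h.pos (next_eq_some_of_mem_sdiff he)).le
  · exact le_rfl

theorem itemGain_nonneg [Fintype E] (e : E) : 0 ≤ itemGain w next e :=
  Finset.sum_nonneg fun i _ => h.ite_weight_nonneg e i

theorem exists_le_itemGain [Fintype E] (he : e ∈ finalStage next) :
    ∃ i < Fintype.card E, e ∉ stage next i ∧ w e (stage next i) ≤ itemGain w next e := by
  obtain ⟨i, hi, hei⟩ := exists_mem_stage_succ_sdiff he
  exact ⟨i, hi, (Finset.mem_sdiff.1 hei).2, (if_pos hei).ge.trans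
    (Finset.single_le_sum (fun i _ => h.ite_weight_nonneg e i) (Finset.mem_range.2 hi))⟩

variable [Fintype E]

theorem exists_blocking_step (hI : IsIndependenceSystem I) {t : E} (ht : {t} ∈ I) (htS : t ∈ S)
    (htA : t ∉ finalStage next) (hpos : 0 < w t (finalStage next)) :
    ∃ j < Fintype.card E,
      insert t (stage next j) ∈ I ∧ insert t (stage next (j + 1)) ∉ I := by
  have hblocked : insert t (finalStage next) ∉ I := by
    intro hmem
    obtain ⟨e, he, -⟩ := h.exists_le htS htA hmem hpos
    simp [h.next_finalStage] at he
  obtain ⟨j, hj, hj'⟩ := Nat.exists_not_and_succ_of_not_zero_of_exists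
    (p := fun i => insert t (stage next i) ∉ I) (not_not.2 ht) ⟨_, hblocked⟩
  rw [not_not] at hj
  refine ⟨j, ?_, hj, hj'⟩
  by_contra! hle
  exact hblocked (hI.2 _ hj _ (Finset.insert_subset_insert t (stage_mono next hle)))

theorem sum_sdiff_finalStage_le {k : ℕ} (hI : IsKSystem I k) (hw : HasDiminishingGains w)
    {T : Finset E} (hT : T ∈ I) (hTS : T ⊆ S) :
    ∑ t ∈ T \ finalStage next, w t (finalStage next) ≤
      k * totalGain w next := by
  classical
  set A := finalStage next
  set Y := (T \ A).filter fun t => 0 < w t A with hY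
  have hYT : Y ⊆ T := (Finset.filter_subset _ _).trans Finset.sdiff_subset
  have hYA : ∀ t ∈ Y, t ∉ A ∧ 0 < w t A := fun t ht => by
    rw [hY, Finset.mem_filter, Finset.mem_sdiff] at ht
    exact ⟨ht.1.2, ht.2⟩
  choose! j hj hjI hjI' using fun t ht => h.exists_blocking_step hI.1
    (hI.1.2 T hT _ (Finset.singleton_subset_iff.2 (hYT ht))) (hTS (hYT ht)) (hYA t ht).1
    (hYA t ht).2
  have hcount (i : ℕ) : (Y.filter fun t => j t < i).card ≤ k * i := by
    refine (hI.card_le_of_insert_notMem (h.stage_mem hI.1.1 i)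
      (hI.1.2 T hT _ ((Finset.filter_subset _ _).trans hYT)) fun t ht _ hmem => ?_).trans
      (Nat.mul_le_mul_left k (card_stage_le next i))
    obtain ⟨htY, hti⟩ := Finset.mem_filter.1 ht
    exact hjI' t htY (hI.1.2 _ hmem _ (Finset.insert_subset_insert t (stage_mono next hti)))
  have hcharge : ∀ t ∈ Y, w t A ≤ stepGain w next (j t) := fun t ht => by
    have hsub : stage next (j t) ⊆ A := stage_mono next (hj t ht).le
    exact (hw hsub t (hYA t ht).1).trans
      (h.le_stepGain (hTS (hYT ht)) (fun hmem => (hYA t ht).1 (hsub hmem)) (hjI t ht))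
  calc ∑ t ∈ T \ A, w t A
      ≤ ∑ t ∈ Y, w t A := by
        rw [hY, Finset.sum_filter]
        exact Finset.sum_le_sum fun t _ => by split_ifs with hpos <;> linarith
    _ ≤ ∑ t ∈ Y, stepGain w next (j t) := Finset.sum_le_sum hcharge
    _ ≤ k * totalGain w next :=
        sum_comp_le_mul_sum_range (h.stepGain_antitone hI.1 hw) h.stepGain_nonneg hj hcount

end IsGreedy

section Family

variable {I : Set (Finset E)} {next : Finset E → Finset E → Option E}

/-- One greedy rule for each set `S` of available items, with coherent tie breaking: the chosen item
is still chosen when other items become unavailable. -/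
structure IsGreedyFamily (I : Set (Finset E)) (w : E → Finset E → ℝ)
    (next : Finset E → Finset E → Option E) : Prop where
  isGreedy : ∀ S, IsGreedy I w S (next S)
  next_of_subset : ∀ {S S' D e}, S ⊆ S' → next S' D = some e → e ∈ S → next S D = some e

theorem stage_eq_stage_of_subset (hF : IsGreedyFamily I w next) {S S' : Finset E}
    (hS : S ⊆ S') (h : ∀ t ∈ S' \ S, t ∉ stage (next (insert t S)) n) :
    stage (next S') n = stage (next S) n := by
  induction n generalizing S' with
  | zero => rfl
  | succ n ih =>
    have hn : ∀ t ∈ S' \ S, t ∉ stage (next (insert t S)) n :=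
      fun t ht hmem => h t ht (stage_mono _ n.le_succ hmem)
    have hD := ih hS hn
    suffices hstep : next S' (stage (next S) n) = next S (stage (next S) n) by
      rw [stage, stage, hD, hstep]
    cases hnext' : next S' (stage (next S) n) with
    | none =>
      refine (Option.eq_none_iff_forall_ne_some.2 fun e he => ?_).symm
      have hgreedy := hF.isGreedy S
      obtain ⟨e', he', -⟩ := (hF.isGreedy S').exists_le (hS (hgreedy.mem he))
        (hgreedy.notMem he) (hgreedy.insert_mem he) (hgreedy.pos he)
      simp [hnext'] at he'
    | some e =>
      by_cases heS : e ∈ S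
      · exact (hF.next_of_subset hS hnext' heS).symm
      · have heS' : e ∈ S' \ S := Finset.mem_sdiff.2 ⟨(hF.isGreedy S').mem hnext', heS⟩
        have hinsert : stage (next (insert e S)) n = stage (next S) n :=
          ih (Finset.subset_insert e S) fun t ht => by
            rw [Finset.insert_sdiff_of_notMem _ heS, Finset.sdiff_self, insert_empty_eq,
              Finset.mem_singleton] at ht
            exact ht ▸ hn e heS'
        have hchosen := hF.next_of_subset
          (Finset.insert_subset (Finset.mem_sdiff.1 heS').1 hS) hnext' (Finset.mem_insert_self e S)
        refine absurd ?_ (h e heS')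
        rw [stage_succ_of_some (hinsert ▸ hchosen)]
        exact Finset.mem_insert_self _ _

variable [Fintype E]

theorem weight_finalStage_le_itemGain (hw : HasDiminishingGains w)
    (hF : IsGreedyFamily I w next) {S : Finset E} {t : E}
    (ht : t ∈ finalStage (next (insert t S))) (htA : t ∉ finalStage (next S)) :
    w t (finalStage (next S)) ≤ itemGain w (next (insert t S)) t := by
  obtain ⟨i, hi, hti, hle⟩ := (hF.isGreedy _).exists_le_itemGain ht
  have hstage : stage (next (insert t S)) i = stage (next S) i := by
    refine stage_eq_stage_of_subset hF (Finset.subset_insert t S) fun t' ht' => ?_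
    obtain rfl : t' = t := by
      rw [Finset.mem_sdiff, Finset.mem_insert] at ht'
      exact ht'.1.resolve_right ht'.2
    exact hti
  rw [hstage] at hle
  exact (hw (stage_mono _ hi.le) t htA).trans hle

theorem sum_weight_finalStage_le {k : ℕ} (hI : IsKSystem I k) (hw : HasDiminishingGains w)
    (hF : IsGreedyFamily I w next) {S Y : Finset E} (hY : Y ∈ I)
    (hYA : ∀ t ∈ Y, t ∉ finalStage (next (insert t S))) :
    ∑ t ∈ Y, w t (finalStage (next S)) ≤ k * totalGain w (next S) := by
  have hstage : ∀ i ≤ Fintype.card E, stage (next (S ∪ Y)) i = stage (next S) i := fun i hi =>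
    stage_eq_stage_of_subset hF Finset.subset_union_left fun t ht hmem => by
      rw [Finset.union_sdiff_left, Finset.mem_sdiff] at ht
      exact hYA t ht.1 (stage_mono _ hi hmem)
  have hfinal : finalStage (next (S ∪ Y)) = finalStage (next S) := hstage _ le_rfl
  have htotal : totalGain w (next (S ∪ Y)) = totalGain w (next S) :=
    Finset.sum_congr rfl fun i hi => by
      have hi := Finset.mem_range.1 hi
      rw [stepGain, stepGain, hstage i hi.le, hstage (i + 1) hi]
  have hdisj : Y \ finalStage (next S) = Y := by
    refine Finset.sdiff_eq_self_of_disjoint (Finset.disjoint_left.2 fun t ht htA => hYA t ht ?_)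
    rwa [Finset.insert_eq_of_mem ((hF.isGreedy S).stage_subset _ htA)]
  have h := (hF.isGreedy (S ∪ Y)).sum_sdiff_finalStage_le hI hw hY Finset.subset_union_right
  rwa [hfinal, htotal, hdisj] at h

/- The items of `T` missed by the greedy rule on `S` are split according to whether the rule on
`insert t S` selects `t`: those it selects are charged to their own gain there, and the others can
be added to `S` all at once without changing the run. -/
theorem sum_sdiff_finalStage_le_add {k : ℕ} (hI : IsKSystem I k) (hw : HasDiminishingGains w)
    (hF : IsGreedyFamily I w next) (S : Finset E) {T : Finset E} (hT : T ∈ I) :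
    ∑ t ∈ T \ finalStage (next S), w t (finalStage (next S)) ≤
      k * totalGain w (next S) + ∑ t ∈ Sᶜ, itemGain w (next (insert t S)) t := by
  rw [← Finset.sum_filter_not_add_sum_filter _ fun t => t ∈ finalStage (next (insert t S))]
  refine add_le_add (sum_weight_finalStage_le hI hw hF (hI.1.2 T hT _
    ((Finset.filter_subset _ _).trans Finset.sdiff_subset)) fun t ht =>
      (Finset.mem_filter.1 ht).2) ?_
  refine (Finset.sum_le_sum fun t ht => ?_).trans
    (Finset.sum_le_sum_of_subset_of_nonneg (fun t ht => ?_)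
      fun t _ _ => (hF.isGreedy _).itemGain_nonneg t)
  · obtain ⟨htT, hmem⟩ := Finset.mem_filter.1 ht
    exact weight_finalStage_le_itemGain hw hF hmem (Finset.mem_sdiff.1 htT).2
  · obtain ⟨htT, hmem⟩ := Finset.mem_filter.1 ht
    rw [Finset.mem_compl]
    intro htS
    rw [Finset.insert_eq_of_mem htS] at hmem
    exact (Finset.mem_sdiff.1 htT).2 hmem

theorem sum_compl_itemGain (hS : ∀ S, finalStage (next S) ⊆ S) :
    ∑ S : Finset E, ∑ t ∈ Sᶜ, itemGain w (next (insert t S)) t =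
      ∑ S : Finset E, totalGain w (next S) := by
  simp_rw [← fun S => sum_itemGain w (hS S)]
  rw [Finset.sum_sigma', Finset.sum_sigma']
  refine Finset.sum_bij' (fun x _ => ⟨insert x.2 x.1, x.2⟩) (fun x _ => ⟨x.1.erase x.2, x.2⟩)
    ?_ ?_ ?_ ?_ ?_
  · simp
  · simp
  · rintro ⟨S, e⟩ h
    have he : e ∉ S := by simpa using h
    simp [he]
  · rintro ⟨S, e⟩ h
    have he : e ∈ S := by simpa using h
    simp [he]
  · simp

theorem sum_sum_sdiff_finalStage_le {k : ℕ} (hI : IsKSystem I k) (hw : HasDiminishingGains w)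
    (hF : IsGreedyFamily I w next) {T : Finset E} (hT : T ∈ I) :
    ∑ S : Finset E, ∑ t ∈ T \ finalStage (next S), w t (finalStage (next S)) ≤
      (k + 1) * ∑ S : Finset E, totalGain w (next S) := by
  refine (Finset.sum_le_sum fun S _ =>
    sum_sdiff_finalStage_le_add hI hw hF S hT).trans_eq ?_
  rw [Finset.sum_add_distrib, ← Finset.mul_sum,
    sum_compl_itemGain fun S => (hF.isGreedy S).stage_subset _]
  ring

end Family

end GreedyRules

section GreedyStep

variable [Fintype E] [DecidableEq E]
  {p : PMF (E → O)} {f : Finset E → (E → O) → ℝ} {I : Set (Finset E)}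
  {tie : PartialRealization E O → (E ↪ ℕ)} {S S' D : Finset E} {ψ : PartialRealization E O}
  {φ : E → O} {e e' : E}

theorem mem_candidates :
    e ∈ candidates p f I S ψ ↔
      e ∈ S ∧ ψ e = none ∧ insert e (dom ψ) ∈ I ∧ 0 < marginal p f e ψ := by
  simp [candidates]

theorem mem_candidates_restrict :
    e ∈ candidates p f I S (restrict φ D) ↔
      e ∈ S ∧ e ∉ D ∧ insert e D ∈ I ∧ 0 < marginal p f e (restrict φ D) := by
  rw [mem_candidates, restrict_eq_none_iff, dom_restrict]

theorem candidates_subset (hS : S ⊆ S') : candidates p f I S ψ ⊆ candidates p f I S' ψ :=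
  fun _ he => mem_candidates.2 ((mem_candidates.1 he).imp_left (@hS _))

theorem IsGreedyChoice.unique {label : E ↪ ℕ} {F : Finset E}
    (h : IsGreedyChoice p f label F ψ e) (h' : IsGreedyChoice p f label F ψ e') : e = e' := by
  have heq : marginal p f e ψ = marginal p f e' ψ :=
    le_antisymm (h'.2.1 e h.1) (h.2.1 e' h'.1)
  exact label.injective (le_antisymm (h.2.2 e' h'.1 heq.symm) (h'.2.2 e h.1 heq))

theorem IsGreedyChoice.of_subset {label : E ↪ ℕ} {F F' : Finset E} (hF : F ⊆ F') (he : e ∈ F)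
    (h : IsGreedyChoice p f label F' ψ e) : IsGreedyChoice p f label F ψ e :=
  ⟨he, fun e' he' => h.2.1 e' (hF he'), fun e' he' => h.2.2 e' (hF he')⟩

theorem isGreedyChoice_of_greedyStep_eq_some (h : greedyStep p f I tie S ψ = some e) :
    IsGreedyChoice p f (tie ψ) (candidates p f I S ψ) ψ e := by
  unfold greedyStep at h
  split_ifs at h with hne
  exact Option.some.inj h ▸ (exists_isGreedyChoice p f (tie ψ) _ ψ hne).choose_spec

theorem exists_greedyStep_eq_some (h : (candidates p f I S ψ).Nonempty) :
    ∃ e, greedyStep p f I tie S ψ = some e :=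
  ⟨_, dif_pos h⟩

theorem greedyStep_eq_some_of_subset (hS : S ⊆ S') (h : greedyStep p f I tie S' ψ = some e)
    (he : e ∈ S) : greedyStep p f I tie S ψ = some e := by
  have hchoice' := isGreedyChoice_of_greedyStep_eq_some h
  have hmem : e ∈ candidates p f I S ψ :=
    mem_candidates.2 ⟨he, (mem_candidates.1 hchoice'.1).2⟩
  obtain ⟨a, ha⟩ := exists_greedyStep_eq_some (tie := tie) ⟨e, hmem⟩
  rw [ha, (isGreedyChoice_of_greedyStep_eq_some ha).unique
    (hchoice'.of_subset (candidates_subset hS) hmem)]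

end GreedyStep

section GreedyRun

variable [Fintype E] [DecidableEq E]
  (p : PMF (E → O)) (f : Finset E → (E → O) → ℝ) (I : Set (Finset E))
  (tie : PartialRealization E O → (E ↪ ℕ))

/-- The next item of the greedy rule on `S` under the realization `φ`, as a function of the set
selected so far. -/
def greedyNext (S : Finset E) (φ : E → O) (D : Finset E) : Option E :=
  greedyStep p f I tie S (restrict φ D)

/-- The set selected by the greedy rule on `S` under the realization `φ`. -/
def greedySet (S : Finset E) (φ : E → O) : Finset E :=
  finalStage (greedyNext p f I tie S φ)

/-- The sum of the conditional expected marginal utilities of the items selected by the greedy rule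
on `S` under the realization `φ`, each taken when the item is selected. -/
def greedyGain (S : Finset E) (φ : E → O) : ℝ :=
  totalGain (fun e D => marginal p f e (restrict φ D)) (greedyNext p f I tie S φ)

variable {p f I tie} {S : Finset E}

theorem isGreedy_greedyNext (S : Finset E) (φ : E → O) :
    IsGreedy I (fun e D => marginal p f e (restrict φ D)) S (greedyNext p f I tie S φ) := by
  have hcandidate {D e} (h : greedyNext p f I tie S φ D = some e) :=
    mem_candidates_restrict.1 (isGreedyChoice_of_greedyStep_eq_some h).1
  refine ⟨fun h => (hcandidate h).1, fun h => (hcandidate h).2.1, fun h => (hcandidate h).2.2.1,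
    fun h => (hcandidate h).2.2.2, fun {D t} htS htD htI hpos => ?_⟩
  have ht : t ∈ candidates p f I S (restrict φ D) :=
    mem_candidates_restrict.2 ⟨htS, htD, htI, hpos⟩
  obtain ⟨e, he⟩ := exists_greedyStep_eq_some (tie := tie) ⟨t, ht⟩
  exact ⟨e, he, (isGreedyChoice_of_greedyStep_eq_some he).2.1 t ht⟩

theorem isGreedyFamily_greedyNext (φ : E → O) :
    IsGreedyFamily I (fun e D => marginal p f e (restrict φ D))
      (greedyNext p f I tie · φ) :=
  ⟨(isGreedy_greedyNext · φ), greedyStep_eq_some_of_subset⟩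

theorem notMem_of_greedyNext {S : Finset E} {φ : E → O} :
    ∀ {D e}, greedyNext p f I tie S φ D = some e → e ∉ D :=
  (isGreedy_greedyNext S φ).notMem

theorem greedySet_subset (S : Finset E) (φ : E → O) : greedySet p f I tie S φ ⊆ S :=
  (isGreedy_greedyNext S φ).stage_subset _

theorem greedySet_mem (hI : ∅ ∈ I) (S : Finset E) (φ : E → O) : greedySet p f I tie S φ ∈ I :=
  (isGreedy_greedyNext S φ).stage_mem hI _

theorem selectedFrom_greedyPolicy (φ : E → O) (n i : ℕ) :
    (greedyPolicy p f I tie S).selectedFrom φ n (stage (greedyNext p f I tie S φ) i) =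
      PMF.pure (stage (greedyNext p f I tie S φ) (i + n)) := by
  induction n generalizing i with
  | zero => exact Policy.selectedFrom_zero _ φ _
  | succ n ih =>
    rw [Policy.selectedFrom_succ]
    change (PMF.pure (greedyNext p f I tie S φ (stage (greedyNext p f I tie S φ) i))).bind _ = _
    rw [PMF.pure_bind]
    cases h : greedyNext p f I tie S φ (stage (greedyNext p f I tie S φ) i) with
    | none => rw [Option.elim_none, stage_add_of_none h]
    | some e => rw [Option.elim_some, ← stage_succ_of_some h, ih, add_right_comm, add_assoc]

theorem selected_greedyPolicy (S : Finset E) (φ : E → O) :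
    (greedyPolicy p f I tie S).selected φ = PMF.pure (greedySet p f I tie S φ) := by
  rw [Policy.selected_eq_selectedFrom]
  simpa only [zero_add] using! selectedFrom_greedyPolicy φ (Fintype.card E) 0

theorem isAdapted_stage_greedyNext (S : Finset E) (n : ℕ) :
    IsAdapted fun φ : E → O => PMF.pure (stage (greedyNext p f I tie S φ) n) := by
  have h (φ : E → O) := selectedFrom_greedyPolicy (p := p) (f := f) (I := I) (tie := tie)
    (S := S) φ n 0
  simp only [zero_add] at h
  simpa only [← h] using! (greedyPolicy p f I tie S).isAdapted_selectedFrom n ∅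

theorem isAdapted_greedySet (S : Finset E) :
    IsAdapted fun φ : E → O => PMF.pure (greedySet p f I tie S φ) :=
  isAdapted_stage_greedyNext S (Fintype.card E)

variable [MeasurableSpace (E → O)] [DiscreteMeasurableSpace (E → O)] {μ : Measure (E → O)}
  {X : E → Finset E → (E → O) → ℝ}

theorem integrable_comp_greedySet {X : Finset E → (E → O) → ℝ} (hX : ∀ D, Integrable (X D) μ)
    (S : Finset E) : Integrable (fun φ => X (greedySet p f I tie S φ) φ) μ := by
  simpa only [mean_pure] using integrable_mean (fun φ => PMF.pure (greedySet p f I tie S φ)) hX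

theorem integrable_totalGain (hX : ∀ e D, Integrable (X e D) μ) (S : Finset E) :
    Integrable (fun φ => totalGain (fun e D => X e D φ) (greedyNext p f I tie S φ)) μ := by
  refine integrable_finsetSum _ fun i _ => ?_
  simp only [stepGain_eq_mean notMem_of_greedyNext]
  exact integrable_mean _ fun D => integrable_mean (X := fun (a : Option E) φ =>
    a.elim 0 fun e => X e D φ) _ fun a => a.casesOn (integrable_zero _ _ _) fun e => hX e D

theorem integral_totalGain_nonneg [IsFiniteMeasure μ] (hX : ∀ e D, CondNonneg μ D (X e D))
    (S : Finset E) :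
    0 ≤ ∫ φ, totalGain (fun e D => X e D φ) (greedyNext p f I tie S φ) ∂μ := by
  refine CondNonneg.integral_nonneg (D := ∅) (.sum fun i _ => ?_)
  simp only [stepGain_eq_mean notMem_of_greedyNext]
  refine .mean (D' := id) (fun D => Finset.empty_subset D) (isAdapted_stage_greedyNext S i)
    fun _ D _ => .mean (D' := fun _ => D) (X := fun (a : Option E) φ =>
      a.elim 0 fun e => X e D φ) (fun _ => subset_rfl) (fun a _ _ h => ?_) fun _ a _ => ?_
  · simp only [greedyNext, show restrict _ D = restrict _ D from dependsOn_restrict D h]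
  · exact a.casesOn (.zero _ D) fun e => hX e D

end GreedyRun

section GreedyUtility

variable [Fintype E] [DecidableEq E]
  [MeasurableSpace (E → O)] [DiscreteMeasurableSpace (E → O)] {p : PMF (E → O)}
  {f : Finset E → (E → O) → ℝ} {I : Set (Finset E)} {tie : PartialRealization E O → (E ↪ ℕ)}

theorem integrable_greedyGain (hf : ∀ S, Integrable (f S) p.toMeasure) (S : Finset E) :
    Integrable (greedyGain p f I tie S) p.toMeasure :=
  integrable_totalGain (integrable_marginal hf) S

theorem integral_greedyGain_le (hf : ∀ S, Integrable (f S) p.toMeasure)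
    (h0 : ∀ S φ, 0 ≤ f S φ) (S : Finset E) :
    ∫ φ, greedyGain p f I tie S φ ∂p.toMeasure ≤
      ∫ φ, f (greedySet p f I tie S φ) φ ∂p.toMeasure := by
  have hset := integrable_comp_greedySet (p := p) (f := f) (I := I) (tie := tie) hf S
  have hgain := integrable_greedyGain (I := I) (tie := tie) hf S
  rw [← sub_nonneg, ← integral_sub hset hgain]
  refine (integral_totalGain_nonneg (p := p) (f := f) (I := I) (tie := tie)
    (condNonneg_gain_sub_marginal hf) S).trans (integral_mono (integrable_totalGain
      (fun e D => (condNonneg_gain_sub_marginal hf e D).1) S) (hset.sub hgain) fun φ => ?_)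
  rw [totalGain_sub, totalGain_increment notMem_of_greedyNext fun D => f D φ]
  exact sub_le_sub_right (sub_le_self _ (h0 ∅ φ)) _

end GreedyUtility

section Mixtures

variable {α β Ω : Type*} [Fintype β] [MeasurableSpace Ω] [DiscreteMeasurableSpace Ω]
  {μ : Measure Ω}

theorem lintegral_tsum_pmf_mul (q : PMF α) (F : α → Ω → ℝ≥0∞) :
    ∫⁻ ω, ∑' a, q a * F a ω ∂μ = ∑' a, q a * ∫⁻ ω, F a ω ∂μ := by
  have hsupport (h : α → ℝ≥0∞) : ∑' a, q a * h a = ∑' a : q.support, q a * h a :=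
    (tsum_subtype_eq_of_support_subset
      ((Function.support_mul_subset_left _ _).trans_eq rfl)).symm
  have : Countable q.support := q.support_countable
  simp only [hsupport]
  rw [lintegral_tsum fun _ => Measurable.of_discrete.aemeasurable]
  exact tsum_congr fun a => lintegral_const_mul _ .of_discrete

theorem ofReal_mean {q : PMF β} {g : β → ℝ} (hg : ∀ b, 0 ≤ g b) :
    ENNReal.ofReal (mean q g) = ∑ b, q b * ENNReal.ofReal (g b) := by
  rw [mean, ENNReal.ofReal_sum_of_nonneg fun b _ => mul_nonneg ENNReal.toReal_nonneg (hg b)]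
  refine Finset.sum_congr rfl fun b _ => ?_
  rw [ENNReal.ofReal_mul ENNReal.toReal_nonneg, ENNReal.ofReal_toReal (q.apply_ne_top b)]

theorem ofReal_mean_bind (q : PMF α) (r : α → PMF β) {g : β → ℝ} (hg : ∀ b, 0 ≤ g b) :
    ENNReal.ofReal (mean (q.bind r) g) = ∑' a, q a * ENNReal.ofReal (mean (r a) g) := by
  simp only [ofReal_mean hg, PMF.bind_apply, ← ENNReal.tsum_mul_right, Finset.mul_sum, mul_assoc]
  exact (Summable.tsum_finsetSum fun _ _ => ENNReal.summable).symm

theorem integral_mean_bind_le {q : PMF α} {r : α → Ω → PMF β} {X : β → Ω → ℝ}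
    (hX : ∀ b, Integrable (X b) μ) (h0 : ∀ b ω, 0 ≤ X b ω) {c : ℝ}
    (hc : ∀ a ∈ q.support, ∫ ω, mean (r a ω) (fun b => X b ω) ∂μ ≤ c) :
    ∫ ω, mean (q.bind fun a => r a ω) (fun b => X b ω) ∂μ ≤ c := by
  have hnonneg (s : Ω → PMF β) : 0 ≤ fun ω => mean (s ω) fun b => X b ω :=
    fun ω => mean_nonneg fun b => h0 b ω
  have hlintegral (s : Ω → PMF β) :
      ENNReal.ofReal (∫ ω, mean (s ω) (fun b => X b ω) ∂μ) =
        ∫⁻ ω, ENNReal.ofReal (mean (s ω) fun b => X b ω) ∂μ :=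
    ofReal_integral_eq_lintegral_ofReal (integrable_mean s hX) (.of_forall (hnonneg s))
  obtain ⟨a₀, ha₀⟩ := q.support_nonempty
  rw [← ENNReal.ofReal_le_ofReal_iff ((integral_nonneg (hnonneg _)).trans (hc a₀ ha₀)), hlintegral]
  simp only [fun ω => ofReal_mean_bind q (fun a => r a ω) fun b => h0 b ω]
  calc ∫⁻ ω, ∑' a, q a * ENNReal.ofReal (mean (r a ω) fun b => X b ω) ∂μ
      = ∑' a, q a * ENNReal.ofReal (∫ ω, mean (r a ω) (fun b => X b ω) ∂μ) := by
        simp only [lintegral_tsum_pmf_mul, hlintegral]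
    _ ≤ ∑' a, q a * ENNReal.ofReal c := by
        refine ENNReal.tsum_le_tsum fun a => ?_
        by_cases ha : a ∈ q.support
        · exact mul_le_mul_right (ENNReal.ofReal_le_ofReal (hc a ha)) _
        · simp [(q.apply_eq_zero_iff a).2 ha]
    _ = ENNReal.ofReal c := by rw [ENNReal.tsum_mul_right, q.tsum_coe, one_mul]

theorem mean_coin_half (h : (1 / 2 : ℝ≥0) ≤ 1) (g : Bool → ℝ) :
    mean (coin (1 / 2) h) g = 1 / 2 * (g true + g false) := by
  have hhalf : (1 - 1 / 2 : ℝ≥0) = 1 / 2 := tsub_eq_of_eq_add (by norm_num)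
  simp only [mean, coin, PMF.ofFintype_apply, Fintype.sum_bool, hhalf, ite_self]
  simp [mul_add]

theorem mean_randomSubset_half [Fintype E] (h : (1 / 2 : ℝ≥0) ≤ 1)
    (g : Finset E → ℝ) :
    mean (randomSubset E (1 / 2) h) g = (1 / 2) ^ Fintype.card E * ∑ S, g S := by
  have hhalf : (1 - 1 / 2 : ℝ≥0) = 1 / 2 := tsub_eq_of_eq_add (by norm_num)
  rw [mean, Finset.mul_sum]
  refine Finset.sum_congr rfl fun S _ => ?_
  rw [randomSubset, PMF.ofFintype_apply, hhalf, ← pow_add, Nat.add_sub_cancel' S.card_le_univ,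
    ENNReal.coe_toReal]
  simp

end Mixtures

section Comparison

variable [Fintype E] [DecidableEq E]
  {p : PMF (E → O)} {f : Finset E → (E → O) → ℝ} {I : Set (Finset E)}
  {tie : PartialRealization E O → (E ↪ ℕ)}

theorem sum_compl {M : Type*} [AddCommMonoid M] (g : Finset E → M) : ∑ S, g Sᶜ = ∑ S, g S :=
  Fintype.sum_bijective compl compl_bijective _ _ fun _ => rfl

theorem selected_sag {δ₀ δ₁ : ℝ≥0} (h₀ : δ₀ ≤ 1) (h₁ : δ₁ ≤ 1) (φ : E → O) :
    selected (sag p f I tie δ₀ δ₁ h₀ h₁) φ =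
      (coin δ₁ h₁).bind fun b => (randomSubset E δ₀ h₀).bind fun S =>
        PMF.pure (greedySet p f I tie (if b then S else Sᶜ) φ) := by
  simp only [selected, sag, PMF.bind_bind, PMF.pure_bind, selected_greedyPolicy]

theorem feasible_sag (hI : ∅ ∈ I) {δ₀ δ₁ : ℝ≥0} (h₀ : δ₀ ≤ 1) (h₁ : δ₁ ≤ 1) :
    Feasible p I (sag p f I tie δ₀ δ₁ h₀ h₁) := by
  intro φ _ T hT
  simp only [selected_sag, PMF.mem_support_bind_iff, PMF.mem_support_pure_iff] at hT
  obtain ⟨b, -, S, -, rfl⟩ := hT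
  exact greedySet_mem hI _ φ

variable [MeasurableSpace (E → O)] [DiscreteMeasurableSpace (E → O)]

theorem sum_sum_marginal_sdiff_greedySet_le (hs : IsAdaptiveSubmodular p f) {k : ℕ}
    (hI : IsKSystem I k) {φ : E → O} (hφ : φ ∈ p.support) {T : Finset E} (hT : T ∈ I) :
    ∑ S, ∑ e ∈ T \ greedySet p f I tie S φ, marginal p f e (restrict φ (greedySet p f I tie S φ)) ≤
      (k + 1) * ∑ S, greedyGain p f I tie S φ := by
  have hdim : HasDiminishingGains fun e D => marginal p f e (restrict φ D) :=
    fun _ _ hD _ he => marginal_restrict_anti hs hφ hD he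
  exact sum_sum_sdiff_finalStage_le hI hdim (isGreedyFamily_greedyNext (tie := tie) φ) hT

theorem integral_union_greedySet_le (hf : ∀ S, Integrable (f S) p.toMeasure)
    (hs : IsAdaptiveSubmodular p f) (π : Policy E O) (S : Finset E) :
    ∫ φ, mean (π.selected φ) (fun T => f (T ∪ greedySet p f I tie S φ) φ) ∂p.toMeasure ≤
      ∫ φ, f (greedySet p f I tie S φ) φ ∂p.toMeasure +
        ∫ φ, mean (π.selected φ) (fun T => ∑ e ∈ T \ greedySet p f I tie S φ,
          marginal p f e (restrict φ (greedySet p f I tie S φ))) ∂p.toMeasure := by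
  have h := integral_union_sub_marginal_le hf hs
    (isAdapted_greedySet (p := p) (f := f) (I := I) (tie := tie) S) π
  simp only [mean_pure, mean_sub] at h
  rwa [integral_sub
    (integrable_mean π.selected fun T => integrable_comp_greedySet (fun C => hf (T ∪ C)) S)
    (integrable_mean π.selected fun T => integrable_comp_greedySet (fun C =>
      integrable_finsetSum (T \ C) fun e _ => integrable_marginal hf e C) S),
    sub_le_iff_le_add] at h

theorem sum_integral_marginal_sdiff_greedySet_le (hf : ∀ S, Integrable (f S) p.toMeasure)
    (h0 : ∀ S φ, 0 ≤ f S φ) (hs : IsAdaptiveSubmodular p f) {k : ℕ} (hI : IsKSystem I k)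
    {q : (E → O) → PMF (Finset E)} (hq : ∀ φ ∈ p.support, ∀ T ∈ (q φ).support, T ∈ I) :
    ∑ S, ∫ φ, mean (q φ) (fun T => ∑ e ∈ T \ greedySet p f I tie S φ,
        marginal p f e (restrict φ (greedySet p f I tie S φ))) ∂p.toMeasure ≤
      (k + 1) * ∑ S, ∫ φ, f (greedySet p f I tie S φ) φ ∂p.toMeasure := by
  have hmissed (S : Finset E) : Integrable (fun φ => mean (q φ) fun T =>
      ∑ e ∈ T \ greedySet p f I tie S φ,
        marginal p f e (restrict φ (greedySet p f I tie S φ))) p.toMeasure :=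
    integrable_mean q fun T => integrable_comp_greedySet (fun C =>
      integrable_finsetSum (T \ C) fun e _ => integrable_marginal hf e C) S
  have hgain (S : Finset E) : Integrable (greedyGain p f I tie S) p.toMeasure :=
    integrable_greedyGain hf S
  rw [← integral_finsetSum _ fun S _ => hmissed S]
  calc ∫ φ, ∑ S, mean (q φ) (fun T => ∑ e ∈ T \ greedySet p f I tie S φ,
        marginal p f e (restrict φ (greedySet p f I tie S φ))) ∂p.toMeasure
      ≤ ∫ φ, (k + 1) * ∑ S, greedyGain p f I tie S φ ∂p.toMeasure := by
        refine integral_mono_ae (integrable_finsetSum _ fun S _ => hmissed S)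
          ((integrable_finsetSum _ fun S _ => hgain S).const_mul _)
          (ae_toMeasure_iff.2 fun φ hφ => ?_)
        beta_reduce
        rw [← mean_sum, ← mean_const (q φ) (_ * _)]
        exact mean_mono fun T hT => sum_sum_marginal_sdiff_greedySet_le hs hI hφ (hq φ hφ T hT)
    _ = (k + 1) * ∑ S, ∫ φ, greedyGain p f I tie S φ ∂p.toMeasure := by
        rw [integral_const_mul, integral_finsetSum _ fun S _ => hgain S]
    _ ≤ (k + 1) * ∑ S, ∫ φ, f (greedySet p f I tie S φ) φ ∂p.toMeasure :=
        mul_le_mul_of_nonneg_left (Finset.sum_le_sum fun S _ => integral_greedyGain_le hf h0 S)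
          (by positivity)

theorem sum_integral_union_greedySet_le (hf : ∀ S, Integrable (f S) p.toMeasure)
    (h0 : ∀ S φ, 0 ≤ f S φ) (hs : IsAdaptiveSubmodular p f) {k : ℕ} (hI : IsKSystem I k)
    {π : Policy E O} (hπ : ∀ φ ∈ p.support, ∀ T ∈ (π.selected φ).support, T ∈ I) :
    ∑ S, ∫ φ, mean (π.selected φ) (fun T => f (T ∪ greedySet p f I tie S φ) φ) ∂p.toMeasure ≤
      (k + 2) * ∑ S, ∫ φ, f (greedySet p f I tie S φ) φ ∂p.toMeasure := by
  have hunion := Finset.sum_le_sum fun S (_ : S ∈ Finset.univ) =>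
    integral_union_greedySet_le (I := I) (tie := tie) hf hs π S
  rw [Finset.sum_add_distrib] at hunion
  linarith [sum_integral_marginal_sdiff_greedySet_le (tie := tie) hf h0 hs hI hπ]

theorem integral_selected_le_union_add_union_compl (hf : ∀ S, Integrable (f S) p.toMeasure)
    (h0 : ∀ S φ, 0 ≤ f S φ) (hs : IsAdaptiveSubmodular p f) (π : Policy E O) (S : Finset E) :
    ∫ φ, mean (π.selected φ) (fun T => f T φ) ∂p.toMeasure ≤
      ∫ φ, mean (π.selected φ) (fun T => f (T ∪ greedySet p f I tie S φ) φ) ∂p.toMeasure +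
        ∫ φ, mean (π.selected φ) (fun T => f (T ∪ greedySet p f I tie Sᶜ φ) φ)
          ∂p.toMeasure := by
  have hdisj (ψ : PartialRealization E O) (e : E)
      (he : some e ∈ ((greedyPolicy p f I tie S).next ψ).support) (φ : E → O) :
      ∀ C ∈ (PMF.pure (greedySet p f I tie Sᶜ φ)).support, e ∉ C := by
    rw [PMF.support_pure]
    rintro C rfl heC
    have hstep : greedyStep p f I tie S ψ = some e := by
      simpa [greedyPolicy, eq_comm] using he
    exact Finset.mem_compl.1 (greedySet_subset Sᶜ φ heC)
      (mem_candidates.1 (isGreedyChoice_of_greedyStep_eq_some hstep).1).1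
  simpa only [selected_greedyPolicy, mean_pure] using
    integral_le_integral_union_add_integral_union hf h0 hs π.isAdapted_selected
      (isAdapted_greedySet Sᶜ) hdisj

theorem two_pow_mul_integral_selected_le (hf : ∀ S, Integrable (f S) p.toMeasure)
    (h0 : ∀ S φ, 0 ≤ f S φ) (hs : IsAdaptiveSubmodular p f) {k : ℕ} (hI : IsKSystem I k)
    {π : Policy E O} (hπ : ∀ φ ∈ p.support, ∀ T ∈ (π.selected φ).support, T ∈ I) :
    2 ^ Fintype.card E * ∫ φ, mean (π.selected φ) (fun T => f T φ) ∂p.toMeasure ≤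
      (2 * k + 4) * ∑ S, ∫ φ, f (greedySet p f I tie S φ) φ ∂p.toMeasure := by
  have hsplit := Finset.sum_le_sum fun S (_ : S ∈ Finset.univ) =>
    integral_selected_le_union_add_union_compl (I := I) (tie := tie) hf h0 hs π S
  rw [Finset.sum_const, Finset.card_univ, Fintype.card_finset, nsmul_eq_mul, Nat.cast_pow,
    Nat.cast_ofNat, Finset.sum_add_distrib, sum_compl fun S => ∫ φ, mean (π.selected φ)
      (fun T => f (T ∪ greedySet p f I tie S φ) φ) ∂p.toMeasure] at hsplit
  linarith [sum_integral_union_greedySet_le (tie := tie) hf h0 hs hI hπ]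

theorem favg_eq_integral (hf : ∀ S, Integrable (f S) p.toMeasure) (π : RandomizedPolicy E O) :
    favg p f π = ∫ φ, mean (selected π φ) (fun S => f S φ) ∂p.toMeasure :=
  (p.integral_eq_tsum _ (integrable_mean (selected π) hf)).symm

theorem favg_sag_half (hf : ∀ S, Integrable (f S) p.toMeasure) (h₀ h₁ : (1 / 2 : ℝ≥0) ≤ 1) :
    favg p f (sag p f I tie (1 / 2) (1 / 2) h₀ h₁) =
      (1 / 2) ^ Fintype.card E * ∑ S, ∫ φ, f (greedySet p f I tie S φ) φ ∂p.toMeasure := by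
  have hmean (φ : E → O) :
      mean (selected (sag p f I tie (1 / 2) (1 / 2) h₀ h₁) φ) (fun S => f S φ) =
        (1 / 2) ^ Fintype.card E * ∑ S, f (greedySet p f I tie S φ) φ := by
    simp only [selected_sag, mean_bind, mean_pure, mean_coin_half, mean_randomSubset_half,
      if_true, Bool.false_eq_true, if_false, sum_compl fun S => f (greedySet p f I tie S φ) φ]
    ring
  simp only [favg_eq_integral hf, hmean]
  rw [integral_const_mul, integral_finsetSum _ fun S _ => integrable_comp_greedySet hf S]

theorem favg_le_mul_favg_sag_half (hf : ∀ S, Integrable (f S) p.toMeasure)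
    (h0 : ∀ S φ, 0 ≤ f S φ) (hs : IsAdaptiveSubmodular p f) {k : ℕ} (hI : IsKSystem I k)
    (h₀ h₁ : (1 / 2 : ℝ≥0) ≤ 1) {π : RandomizedPolicy E O} (hπ : Feasible p I π) :
    favg p f π ≤ (2 * k + 4) * favg p f (sag p f I tie (1 / 2) (1 / 2) h₀ h₁) := by
  rw [favg_eq_integral hf, favg_sag_half hf]
  refine integral_mean_bind_le hf h0 fun π' hπ' => ?_
  have hfeasible : ∀ φ ∈ p.support, ∀ T ∈ (π'.selected φ).support, T ∈ I := fun φ hφ T hT =>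
    hπ φ hφ T ((PMF.mem_support_bind_iff _ _ _).2 ⟨π', hπ', hT⟩)
  rw [mul_left_comm, one_div, inv_pow, le_inv_mul_iff₀ (by positivity)]
  exact two_pow_mul_integral_selected_le hf h0 hs hI hfeasible

end Comparison

end AdaptiveSubmodular

end

theorem mainTheorem2 {E : Type*} {O : Type*} [Fintype E] [DecidableEq E]
    (p : PMF (E → O)) (f : Finset E → (E → O) → ℝ)
    (hf_nonneg : ∀ S φ, 0 ≤ f S φ)
    (hf_int : ∀ S, Summable fun φ => (p φ).toReal * f S φ)
    (hf : AdaptiveSubmodular.IsAdaptiveSubmodular p f)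
    (I : Set (Finset E)) (k : ℕ) (hI : AdaptiveSubmodular.IsKSystem I k)
    (tie : AdaptiveSubmodular.PartialRealization E O → (E ↪ ℕ))
    (δ₀ δ₁ : NNReal) (h₀ : δ₀ ≤ 1) (h₁ : δ₁ ≤ 1) (hδ₀ : δ₀ = 1 / 2) (hδ₁ : δ₁ = 1 / 2) :
    AdaptiveSubmodular.Feasible p I (AdaptiveSubmodular.sag p f I tie δ₀ δ₁ h₀ h₁) ∧
    ∀ πopt : AdaptiveSubmodular.RandomizedPolicy E O, AdaptiveSubmodular.Feasible p I πopt →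
      1 / (2 * (k : ℝ) + 4) * AdaptiveSubmodular.favg p f πopt ≤
        AdaptiveSubmodular.favg p f (AdaptiveSubmodular.sag p f I tie δ₀ δ₁ h₀ h₁) := by
  refine ⟨AdaptiveSubmodular.feasible_sag hI.1.1 h₀ h₁, fun πopt hopt => ?_⟩
  let _ : MeasurableSpace (E → O) := ⊤
  have : DiscreteMeasurableSpace (E → O) := ⟨fun _ => trivial⟩
  subst hδ₀ hδ₁
  rw [one_div, inv_mul_le_iff₀ (by positivity)]
  exact AdaptiveSubmodular.favg_le_mul_favg_sag_half
    (fun S => AdaptiveSubmodular.integrable_toMeasure_of_summable (hf_int S)) hf_nonneg hf hI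
    h₀ h₁ hopt
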